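/- Theorem (characteristic $p$, partial radical). An algebraic circuit over a field $K$ is a directed acyclic graph whose leaves are labelled by variables $x_1,\dots,x_n$ or by constants of $K$ and whose other nodes are addition and multiplication gates (of arbitrary fan-in; parallel edges are allowed); its size is its number of nodes plus its number of edges, and for $h\in K[x_1,\dots,x_n]$ let $\mathrm{size}_K(h)$ be the least size of a circuit over $K$ that computes $h$. For a nonzero polynomial $u=c\prod_i h_i^{e_i}$ over a field $F$ with $c\in F^{*}$, pairwise non-associate irreducible $h_i \in F[x_1,\dots,x_n]$ and $e_i\ge 1$, put $\mathrm{rad}_p(u):=\prod_{i:\,p\nmid e_i}h_i$ (well defined up to a nonzero constant). There is an absolute constant $C$ such that the following holds. Let $F$ be a field of characteristic $p\ge 2$, let $n\ge 0$, and let $f,u_0,u_1\in F[x_1,\dots,x_n]$ with $f=u_0u_1$, $f\neq 0$ and $\mathrm{size}_F(f)+\mathrm{size}_F(u_0)\le s$. Then every factor $g\in F[x_1,\dots,x_n]$ of $\mathrm{rad}_p(u_1)$ satisfies $$\mathrm{size}_{\overline F}(g)\;\le\; C\,\bigl(s+\deg \mathrm{rad}_p(u_1)\bigr)^{C},$$ where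 $\overline F$ is the algebraic closure of $F$. -/

import Mathlib

/-- A node of an algebraic circuit in `n` variables over `F`, when `k` nodes are already available:
a leaf labelled by a variable or by a field constant, or an addition or multiplication gate, of
arbitrary fan-in, with the list of the nodes that feed it (one entry for each incoming edge). -/
inductive CircuitGate (n : ℕ) (F : Type*) (k : ℕ) where
  | var (i : Fin n) : CircuitGate n F k
  | const (c : F) : CircuitGate n F k
  | add (inputs : List (Fin k)) : CircuitGate n F k
  | mul (inputs : List (Fin k)) : CircuitGate n F k

namespace CircuitGate

variable {n : ℕ} {F : Type*} {k : ℕ}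

/-- The number of edges that enter a node. -/
def fanIn : CircuitGate n F k → ℕ
  | var _ => 0
  | const _ => 0
  | add l => l.length
  | mul l => l.length

/-- The polynomial at a node, given the polynomials at the nodes below it. -/
noncomputable def value [CommSemiring F] (v : Fin k → MvPolynomial (Fin n) F) :
    CircuitGate n F k → MvPolynomial (Fin n) F
  | var i => MvPolynomial.X i
  | const c => MvPolynomial.C c
  | add l => (l.map v).sum
  | mul l => (l.map v).prod

end CircuitGate

/-- An algebraic circuit with `k` nodes: a directed acyclic graph, its nodes listed in a topological
order, so that all edges into a node come from nodes that are earlier in the list. -/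
inductive AlgCircuit (n : ℕ) (F : Type*) : ℕ → Type _ where
  | nil : AlgCircuit n F 0
  | snoc {k : ℕ} (c : AlgCircuit n F k) (g : CircuitGate n F k) : AlgCircuit n F (k + 1)

namespace AlgCircuit

variable {n : ℕ} {F : Type*}

/-- The size of a circuit: the number of its nodes plus the number of its edges. -/
def size : {k : ℕ} → AlgCircuit n F k → ℕ
  | _, nil => 0
  | _, snoc c g => c.size + (1 + g.fanIn)

/-- The polynomials computed at the nodes of a circuit. -/
noncomputable def value [CommSemiring F] :
    {k : ℕ} → AlgCircuit n F k → Fin k → MvPolynomial (Fin n) F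
  | _, nil => Fin.elim0
  | _, snoc c g => Fin.snoc (α := fun _ => MvPolynomial (Fin n) F) c.value (g.value c.value)

/-- A circuit computes `f` if `f` is the polynomial at one of its nodes (the output node). -/
def Computes [CommSemiring F] {k : ℕ} (c : AlgCircuit n F k) (f : MvPolynomial (Fin n) F) : Prop :=
  ∃ o : Fin k, c.value o = f

end AlgCircuit

/-- `size(f)` over the field of constants `F`: the least size of a circuit over `F` computing `f`. -/
noncomputable def circuitSize {n : ℕ} {F : Type*} [CommSemiring F] (f : MvPolynomial (Fin n) F) :
    ℕ∞ :=
  ⨅ (k : ℕ) (c : AlgCircuit n F k) (_ : c.Computes f), (c.size : ℕ∞)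

theorem circuitSize_le_iff {n : ℕ} {F : Type*} [CommSemiring F] (f : MvPolynomial (Fin n) F)
    (s : ℕ) :
    circuitSize f ≤ s ↔ ∃ (k : ℕ) (c : AlgCircuit n F k), c.Computes f ∧ c.size ≤ s := by
  constructor
  · intro h
    by_contra! hc
    have h1 : ((s + 1 : ℕ) : ℕ∞) ≤ circuitSize f :=
      le_iInf fun k => le_iInf fun c => le_iInf fun hf => by exact_mod_cast hc k c hf
    have h2 : ((s + 1 : ℕ) : ℕ∞) ≤ (s : ℕ∞) := h1.trans h
    have h3 : s + 1 ≤ s := by exact_mod_cast h2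
    omega
  · rintro ⟨k, c, hf, hs⟩
    exact (iInf_le_of_le k (iInf_le_of_le c (iInf_le _ hf))).trans (by exact_mod_cast hs)

open Classical in
/-- The partial radical `rad_p(u)` of a nonzero polynomial `u`: the product of the irreducible
factors of `u` (one from each class of associates) whose multiplicity in `u` is not divisible by
`p`. It is determined up to a nonzero constant; the choice of a representative of each irreducible
factor is that of the normalization used here. -/
noncomputable def partialRadical {n : ℕ} {F : Type*} [Field F] (p : ℕ)
    (u : MvPolynomial (Fin n) F) : MvPolynomial (Fin n) F :=
  letI : StrongNormalizationMonoid (MvPolynomial (Fin n) F) :=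
    UniqueFactorizationMonoid.strongNormalizationMonoid
  ∏ h ∈ (UniqueFactorizationMonoid.normalizedFactors u).toFinset with ¬ p ∣ multiplicity h u, h

/-! For a derivation `D`, put `A = D f * u₀ - f * D u₀` and `B = f * u₀`. Then `A / B = D u₁ / u₁ =
∑ e_i D h_i / h_i`. The terms with `p ∣ e_i` vanish, so the reduced denominator `R` of this fraction
divides the partial radical, even when the degrees of `f` and `u₀` are exponential in `s`. An
irreducible factor `h` of the partial radical really occurs in `R`, exactly once, as soon as `h ∤ D
h`. Such a `D` exists over every field of characteristic `p` (`exists_derivation_not_dvd`): a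
partial derivative, or, if all of these kill `h`, a derivation of `F` applied to the coefficients.
This gives `A * R = B * N` with `R = h * h'`, `h` and `h'` coprime, and the degrees of `R` and `N`
bounded by that of the partial radical (`exists_reduced_fraction`).

It remains to compute `h` from `A` and `B`. All polynomials are expanded at `a + y b + τ (x - a)`:
for `τ = 0` this is a line over the field of constants, and for `τ = 1`, `y = 0` it is the point
`x`. Only a polynomial number of coefficients in `y` and `τ` is needed; for `A` and `B` they are
found gate by gate with the Leibniz rule (`StraightLine.exists_coeff_lineExpansion`). The
`τ`-coefficients of `R` and `N` then follow recursively from `A * R = B * N`, by uniqueness of Padé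
approximants on the line (`StraightLine.exists_coeff_fraction`), and those of `h` follow from `R = h
* h'` by Hensel lifting (`StraightLine.exists_coeff_factor`). Each step of either recursion solves a
linear system whose matrix has entries in the field of constants, so its left inverse consists of
circuit constants and no division is needed (`StraightLine.solve`).

The line must keep `R, N` and `h, h'` coprime and avoid zeros of `B` and of the leading form of `R`
(`exists_line`). Such a line is found over an infinite field, which is why the circuits live over
the algebraic closure. A general factor `g` is the product of at most `deg g` irreducible ones and a
unit. -/

/-! ### Derivations that detect an irreducible polynomial -/

section Derivations

/-- A `p`-th root of `z ^ p` that is not in the subfield `E` generates a degree `p` extension. -/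
theorem Subfield.finrank_adjoin_of_pow_mem {F : Type*} [Field F] (p : ℕ) [hp : Fact p.Prime]
    [CharP F p] (E : Subfield F) (z : F) (hz : z ∉ E) (hzp : z ^ p ∈ E) :
    minpoly E z = Polynomial.X ^ p - Polynomial.C (⟨z ^ p, hzp⟩ : E) ∧
      Module.finrank E (IntermediateField.adjoin E {z}) = p := by
  have hirr : Irreducible (Polynomial.X ^ p - Polynomial.C (⟨z ^ p, hzp⟩ : E)) := by
    refine X_pow_sub_C_irreducible_of_prime hp.out fun b hb => hz ?_
    have h1 : (b : F) ^ p = z ^ p := congrArg Subtype.val hb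
    have h2 : (b : F) = z := frobenius_inj F p h1
    exact h2 ▸ b.2
  have hroot : Polynomial.aeval z (Polynomial.X ^ p - Polynomial.C (⟨z ^ p, hzp⟩ : E)) = 0 := by
    simp only [map_sub, map_pow, Polynomial.aeval_X, Polynomial.aeval_C]
    exact sub_self _
  have hmin := (minpoly.eq_of_irreducible_of_monic hirr hroot
    (Polynomial.monic_X_pow_sub_C _ hp.out.ne_zero)).symm
  refine ⟨hmin, ?_⟩
  rw [IntermediateField.adjoin.finrank, hmin, Polynomial.natDegree_X_pow_sub_C]
  exact ⟨_, Polynomial.monic_X_pow_sub_C _ hp.out.ne_zero, hroot⟩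

/-- In characteristic `p`, an element that is not a `p`-th power is moved by some derivation. -/
theorem exists_derivation_ne_zero {F : Type*} [Field F] (p : ℕ) [hp : Fact p.Prime]
    [CharP F p] (c : F) (hc : ∀ x, x ^ p ≠ c) : 
    ∃ δ : F →+ F, (∀ a b, δ (a * b) = a * δ b + b * δ a) ∧ δ c ≠ 0 := by
  -- `E` is maximal among the subfields that contain all `p`-th powers but not `c`.
  obtain ⟨E, hE0, hE⟩ := zorn_le_nonempty₀
      {E : Subfield F | (frobenius F p).fieldRange ≤ E ∧ c ∉ E} (by
    intro ch hch hchain y hy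
    refine ⟨sSup ch, ⟨(hch hy).1.trans (le_sSup hy), fun hmem => ?_⟩, fun z hz => le_sSup hz⟩
    obtain ⟨s, hs, hcs⟩ :=
      (Subfield.mem_sSup_of_directedOn ⟨y, hy⟩ hchain.directedOn).1 hmem
    exact (hch hs).2 hcs) (frobenius F p).fieldRange
      ⟨le_rfl, fun ⟨x, hx⟩ => hc x hx⟩
  have hpow : ∀ x : F, x ^ p ∈ E := fun x => hE0 ⟨x, rfl⟩
  obtain ⟨hmin, hfin⟩ := E.finrank_adjoin_of_pow_mem p c hE.prop.2 (hpow c)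
  -- For `z ∉ E`, maximality puts `c` into `E(z)`; both `E(c)` and `E(z)` have degree `p` over `E`,
  -- so they coincide and contain `z`.
  have htop : IntermediateField.adjoin E {c} = ⊤ := by
    refine eq_top_iff.2 fun z _ => ?_
    by_cases hz : z ∈ E
    · exact (IntermediateField.adjoin E {c}).algebraMap_mem ⟨z, hz⟩
    obtain ⟨-, hfz⟩ := E.finrank_adjoin_of_pow_mem p z hz (hpow z)
    have hle : E ≤ (IntermediateField.adjoin E {z}).toSubfield := fun x hx =>
      (IntermediateField.adjoin E {z}).algebraMap_mem ⟨x, hx⟩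
    have hcz : c ∈ IntermediateField.adjoin E {z} := by
      by_contra hcz
      exact hz (hE.le_of_ge ⟨hE0.trans hle, hcz⟩ hle (IntermediateField.mem_adjoin_simple_self E z))
    have : FiniteDimensional E (IntermediateField.adjoin E {z}) :=
      FiniteDimensional.of_finrank_pos (by rw [hfz]; exact hp.out.pos)
    have heq : IntermediateField.adjoin E {c} = IntermediateField.adjoin E {z} :=
      IntermediateField.eq_of_le_of_finrank_eq
        (IntermediateField.adjoin_simple_le_iff.2 hcz) (hfin.trans hfz.symm)
    rw [heq]
    exact IntermediateField.mem_adjoin_simple_self E z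
  have hint : IsIntegral E c := ⟨Polynomial.X ^ p - Polynomial.C ⟨c ^ p, hpow c⟩,
    Polynomial.monic_X_pow_sub_C _ hp.out.ne_zero, by
      simp only [Polynomial.eval₂_sub, Polynomial.eval₂_pow, Polynomial.eval₂_X,
        Polynomial.eval₂_C]
      exact sub_self _⟩
  have hsurj : Function.Surjective (Polynomial.aeval (R := E) c) := by
    intro z
    have hz : z ∈ (IntermediateField.adjoin E {c}).toSubalgebra := by rw [htop]; trivial
    rw [IntermediateField.adjoin_simple_toSubalgebra_of_isAlgebraic hint.isAlgebraic] at hz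
    rw [Algebra.adjoin_singleton_eq_range_aeval] at hz
    exact hz
  -- The minimal polynomial `X ^ p - c ^ p` has derivative zero, so `d/dX` preserves the ideal it
  -- generates and descends to `F = E[X] / (X ^ p - c ^ p)`, with value `1` at `c`.
  have hker : ∀ g : Polynomial E, Polynomial.aeval c g = 0 →
      Polynomial.aeval c (Polynomial.derivative' g) = 0 := by
    intro g hg
    obtain ⟨q, rfl⟩ := minpoly.dvd E c hg
    have h0 : Polynomial.derivative (minpoly E c) = 0 := by
      rw [hmin]; simp [Polynomial.derivative_X_pow]
    simp [Polynomial.derivative'_apply, h0]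
  let δ := Derivation.liftOfSurjective (f := Polynomial.aeval (R := E) c) hsurj
    (d := Polynomial.derivative') hker
  refine ⟨δ.toLinearMap.toAddMonoidHom, fun a b => δ.leibniz a b, ?_⟩
  have := Derivation.liftOfSurjective_apply (f := Polynomial.aeval (R := E) c) hsurj
    (d := Polynomial.derivative') hker Polynomial.X
  rw [Polynomial.aeval_X] at this
  change δ c ≠ 0
  rw [this]
  simp [Polynomial.derivative'_apply]

namespace MvPolynomial

variable {σ F : Type*} [Field F]

/-- The additive map of `F[σ]` that applies an additive map of `F` to the coefficients. -/
noncomputable def mapCoeffs (δ : F →+ F) : MvPolynomial σ F →+ MvPolynomial σ F :=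
  AddMonoidHom.mk' (fun P => ∑ α ∈ P.support, monomial α (δ (coeff α P))) fun P Q => by
    classical
    have key : ∀ P β, coeff β (∑ α ∈ P.support, monomial α (δ (coeff α P))) =
        δ (coeff β (P : MvPolynomial σ F)) := by
      intro P β
      simp only [coeff_sum, coeff_monomial, Finset.sum_ite_eq', mem_support_iff]
      split_ifs with h
      · rfl
      · rw [not_not.1 h, map_zero]
    ext β
    rw [coeff_add, key, key, key, coeff_add, map_add]

theorem coeff_mapCoeffs (δ : F →+ F) (P : MvPolynomial σ F) (β : σ →₀ ℕ) :
    coeff β (mapCoeffs δ P) = δ (coeff β P) := by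
  classical
  change coeff β (∑ α ∈ P.support, monomial α (δ (coeff α P))) = _
  simp only [coeff_sum, coeff_monomial, Finset.sum_ite_eq', mem_support_iff]
  split_ifs with h
  · rfl
  · rw [not_not.1 h, map_zero]

theorem mapCoeffs_monomial (δ : F →+ F) (α : σ →₀ ℕ) (c : F) :
    mapCoeffs δ (monomial α c) = monomial α (δ c) := by
  classical
  ext β
  rw [coeff_mapCoeffs, coeff_monomial, coeff_monomial]
  split_ifs
  · rfl
  · exact map_zero δ

theorem mapCoeffs_mul (δ : F →+ F) (hδ : ∀ a b, δ (a * b) = a * δ b + b * δ a)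
    (P Q : MvPolynomial σ F) :
    mapCoeffs δ (P * Q) = P * mapCoeffs δ Q + Q * mapCoeffs δ P := by
  induction P using MvPolynomial.induction_on' with
  | add P₁ P₂ h₁ h₂ => rw [add_mul, map_add, h₁, h₂, map_add]; ring
  | monomial α c =>
    induction Q using MvPolynomial.induction_on' with
    | add Q₁ Q₂ h₁ h₂ => rw [mul_add, map_add, h₁, h₂, map_add]; ring
    | monomial β d =>
      rw [monomial_mul, mapCoeffs_monomial, mapCoeffs_monomial, mapCoeffs_monomial, monomial_mul,
        monomial_mul, hδ, add_comm β α, map_add]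

theorem totalDegree_mapCoeffs_le (δ : F →+ F) (P : MvPolynomial σ F) :
    (mapCoeffs δ P).totalDegree ≤ P.totalDegree := by
  refine totalDegree_le_of_support_subset fun α hα => ?_
  rw [mem_support_iff, coeff_mapCoeffs] at hα
  rw [mem_support_iff]
  exact fun h => hα (by rw [h, map_zero])

theorem totalDegree_pderiv_le (i : σ) (P : MvPolynomial σ F) :
    (pderiv i P).totalDegree ≤ P.totalDegree - 1 := by
  refine Finset.sup_le fun α hα => ?_
  rw [mem_support_iff, coeff_pderiv] at hα
  have := le_totalDegree (mem_support_iff.2 (left_ne_zero_of_mul hα))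
  rw [Finsupp.sum_add_index' (fun _ => rfl) (fun _ _ _ => rfl), Finsupp.sum_single_index rfl] at this
  omega

/-- A polynomial is a constant times a `p`-th power if its exponents are divisible by `p` and the
ratios of its coefficients are `p`-th powers. -/
theorem exists_eq_C_mul_pow (p : ℕ) [hp : Fact p.Prime] [CharP F p] (h : MvPolynomial σ F)
    (hexp : ∀ α ∈ h.support, ∀ i, p ∣ α i) (c : F)
    (hc : ∀ α ∈ h.support, ∃ x, c * x ^ p = coeff α h) :
    ∃ q : MvPolynomial σ F, h = C c * q ^ p := by
  classical
  choose! x hx using hc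
  refine ⟨∑ α ∈ h.support, monomial (α.mapRange (· / p) (Nat.zero_div p)) (x α), ?_⟩
  rw [sum_pow_char, Finset.mul_sum]
  conv_lhs => rw [h.as_sum]
  refine Finset.sum_congr rfl fun α hα => ?_
  rw [monomial_pow, C_mul_monomial, hx α hα]
  congr 2
  ext i
  simp [Nat.mul_div_cancel' (hexp α hα i)]

/-- Some derivation of `F[σ]` maps a given irreducible polynomial to a polynomial that it does not
divide; this derivation does not raise degrees and preserves constants. -/
theorem exists_derivation_not_dvd (p : ℕ) [hp : Fact p.Prime] [CharP F p] (h : MvPolynomial σ F)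
    (hh : Irreducible h) : ∃ D : MvPolynomial σ F →+ MvPolynomial σ F,
      (∀ P Q, D (P * Q) = P * D Q + Q * D P) ∧ ¬ h ∣ D h ∧ (∀ c, ∃ c', D (C c) = C c') ∧ (∀ i, ∃ c', D (X i) = C c') ∧
        ∀ P, (D P).totalDegree ≤ P.totalDegree := by
  classical
  -- If all partial derivatives vanish, `h` is a polynomial in the `p`-th powers of the variables
  -- and the derivation must come from `F`. Otherwise a nonzero partial derivative has smaller
  -- degree than `h`, hence is not a multiple of it.
  by_cases h1 : ∀ i, pderiv i h = 0
  · have hexp : ∀ α ∈ h.support, ∀ i, p ∣ α i := by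
      intro α hα i
      by_contra hpi
      have hpos : α i ≠ 0 := fun h0 => hpi (h0 ▸ dvd_zero p)
      have h2 := congrArg (coeff (α - Finsupp.single i 1)) (h1 i)
      have h3 : α - Finsupp.single i 1 + Finsupp.single i 1 = α := by
        ext j
        by_cases hj : i = j
        · subst hj; simp; omega
        · simp [hj]
      rw [coeff_pderiv, h3, coeff_zero, mul_eq_zero] at h2
      refine h2.elim (mem_support_iff.1 hα) fun h4 => hpi ?_
      rw [← CharP.cast_eq_zero_iff F p]
      have h5 : (α - Finsupp.single i 1 : σ →₀ ℕ) i + 1 = α i := by simp; omega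
      rw [← h5]; exact_mod_cast h4
    obtain ⟨β, hβ⟩ := Finset.nonempty_of_ne_empty (mt support_eq_empty.1 hh.ne_zero)
    have hβ0 := mem_support_iff.1 hβ
    -- If all ratios were `p`-th powers, `h` would be a constant times a `p`-th power and so
    -- reducible.
    have h2 : ∃ α ∈ h.support, ∀ x, x ^ p ≠ coeff α h / coeff β h := by
      by_contra! hcon
      obtain ⟨q, hq⟩ := exists_eq_C_mul_pow p h hexp (coeff β h) fun α hα => by
        obtain ⟨x, hx⟩ := hcon α hα
        exact ⟨x, by rw [hx, mul_div_cancel₀ _ hβ0]⟩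
      have hu : IsUnit (C (coeff β h) : MvPolynomial σ F) := (IsUnit.mk0 _ hβ0).map C
      rw [hq, irreducible_isUnit_mul hu] at hh
      exact not_irreducible_pow hp.out.ne_one hh
    obtain ⟨α, -, hαx⟩ := h2
    obtain ⟨δ, hmul, hδ⟩ := exists_derivation_ne_zero p _ hαx
    refine ⟨mapCoeffs δ, mapCoeffs_mul δ hmul, ?_, fun c => ⟨δ c, ?_⟩, fun i => ⟨0, ?_⟩,
      totalDegree_mapCoeffs_le δ⟩
    · rintro ⟨w, hw⟩
      have hwC : ∃ e, w = C e := by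
        by_cases hw0 : w = 0
        · exact ⟨0, by rw [hw0, C_0]⟩
        have h3 := totalDegree_mapCoeffs_le δ h
        rw [hw, totalDegree_mul_of_isDomain hh.ne_zero hw0] at h3
        exact ⟨_, totalDegree_eq_zero_iff_eq_C.1 (by omega)⟩
      obtain ⟨e, rfl⟩ := hwC
      -- If `h` divided its image, the quotient would be a constant `e` by degree. All coefficients
      -- would then have the same logarithmic derivative, and `δ` would kill their ratios.
      have hco : ∀ γ, δ (coeff γ h) = coeff γ h * e := fun γ => by
        rw [← coeff_mapCoeffs, hw, mul_comm, coeff_C_mul, mul_comm]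
      refine hδ ?_
      have h4 : coeff α h = coeff α h / coeff β h * coeff β h := (div_mul_cancel₀ _ hβ0).symm
      have h5 := hco α
      rw [h4, hmul, hco β] at h5
      have h6 : coeff β h * δ (coeff α h / coeff β h) = 0 := by linear_combination h5
      exact (mul_eq_zero.1 h6).resolve_left hβ0
    · ext γ
      rw [coeff_mapCoeffs, coeff_C, coeff_C]
      split_ifs
      · rfl
      · exact map_zero δ
    · ext γ
      rw [coeff_mapCoeffs, coeff_X, C_0, coeff_zero]
      split_ifs
      · have h7 := hmul 1 1
        rw [one_mul, one_mul] at h7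
        exact left_eq_add.1 h7
      · exact map_zero δ
  · push Not at h1
    obtain ⟨i, hi⟩ := h1
    refine ⟨(pderiv i).toLinearMap.toAddMonoidHom, fun P Q => (pderiv i).leibniz P Q, fun hdvd => ?_, fun c => ⟨0, ?_⟩, fun j => ?_,
      fun P => (totalDegree_pderiv_le i P).trans (Nat.sub_le _ _)⟩
    · have h2 := totalDegree_le_of_dvd_of_isDomain hdvd hi
      have h3 := totalDegree_pderiv_le i h
      have h4 : h.totalDegree ≠ 0 := fun h0 => by
        rw [totalDegree_eq_zero_iff_eq_C.1 h0, pderiv_C] at hi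
        exact hi rfl
      change h.totalDegree ≤ (pderiv i h).totalDegree at h2
      omega
    · rw [C_0]; exact pderiv_C
    · change ∃ c', pderiv i (X j) = C c'
      by_cases hj : j = i
      · subst hj; exact ⟨1, by rw [pderiv_X_self, C_1]⟩
      · exact ⟨0, by rw [pderiv_X_of_ne hj, C_0]⟩

end MvPolynomial

end Derivations

/-! ### The denominator of a logarithmic derivative -/

section LogDerivative

open UniqueFactorizationMonoid

/-- Up to units, `a` is built from prime powers by coprime products, and coprime divisors of `b`
multiply to a divisor of `b`. -/
theorem UniqueFactorizationMonoid.dvd_of_forall_prime_pow_dvd {R : Type*} [CommRing R] [IsDomain R]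
    [UniqueFactorizationMonoid R] {a b : R} (ha : a ≠ 0)
    (h : ∀ q k, Prime q → q ^ k ∣ a → q ^ k ∣ b) : a ∣ b := by
  suffices H : ∀ a : R, a ≠ 0 → (∀ q k, Prime q → q ^ k ∣ a → q ^ k ∣ b) → a ∣ b from H a ha h
  intro a
  induction a using induction_on_coprime with
  | h0 => exact fun h => absurd rfl h
  | h1 hx => exact fun _ _ => hx.dvd
  | hpr i hp => exact fun _ h => h _ _ hp dvd_rfl
  | hcp hxy hx hy =>
    intro h0 h
    exact hxy.mul_dvd (hx (left_ne_zero_of_mul h0) fun q k hq hd => h q k hq (hd.mul_right _))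
      (hy (right_ne_zero_of_mul h0) fun q k hq hd => h q k hq (hd.mul_left _))

/-- Write `u = q ^ e * w` with `q` prime and `q ∤ w`. -/
theorem exists_eq_pow_multiplicity_mul {R : Type*} [CommRing R] [IsDomain R]
    [UniqueFactorizationMonoid R] {q u : R} (hq : Prime q) (hu : u ≠ 0) :
    ∃ w, u = q ^ multiplicity q u * w ∧ ¬ q ∣ w :=
  (FiniteMultiplicity.of_prime_left hq hu).exists_eq_pow_mul_and_not_dvd

theorem leibniz_pow_of_leibniz {R : Type*} [CommRing R] (D : R →+ R)
    (hDmul : ∀ a b, D (a * b) = a * D b + b * D a) (q : R) (e : ℕ) :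
    D (q ^ e) = (e : R) * q ^ (e - 1) * D q := by
  induction e with
  | zero =>
    have h := hDmul 1 1
    rw [one_mul, one_mul] at h
    rw [pow_zero, left_eq_add.1 h, Nat.cast_zero, zero_mul, zero_mul]
  | succ e ih =>
    rw [pow_succ, hDmul, ih, Nat.add_sub_cancel]
    cases e with
    | zero => simp
    | succ e => rw [Nat.add_sub_cancel]; push_cast; ring

/-- The denominator of the logarithmic derivative `D u / u` divides every multiple of the prime
factors of `u` whose multiplicity is not divisible by the characteristic. -/
theorem dvd_derivation_mul {R : Type*} [CommRing R] [IsDomain R] [UniqueFactorizationMonoid R]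
    (p : ℕ) [CharP R p] (D : R →+ R)
    (hDmul : ∀ a b, D (a * b) = a * D b + b * D a) {u r : R} (hu : u ≠ 0)
    (hr : ∀ q, Prime q → q ∣ u → ¬ p ∣ multiplicity q u → q ∣ r) : u ∣ D u * r := by
  refine dvd_of_forall_prime_pow_dvd hu fun q k hq hk => ?_
  obtain ⟨w, hw, hqw⟩ := exists_eq_pow_multiplicity_mul hq hu
  set e := multiplicity q u with he
  have hke : k ≤ e := (FiniteMultiplicity.of_prime_left hq hu).le_multiplicity_of_pow_dvd hk
  refine (pow_dvd_pow q hke).trans ?_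
  rcases Nat.eq_zero_or_pos e with h0 | hpos
  · rw [h0, pow_zero]; exact one_dvd _
  have hD : D u = q ^ e * D w + w * ((e : R) * q ^ (e - 1) * D q) := by
    conv_lhs => rw [hw]
    rw [hDmul, leibniz_pow_of_leibniz D hDmul]
  -- For `p ∣ e` the term in which a power of `q` is lost has coefficient zero. For `p ∤ e` only `q
  -- ^ (e - 1)` is guaranteed to divide `D u`, and `r` supplies the missing `q`.
  by_cases hp : p ∣ e
  · rw [hD, (CharP.cast_eq_zero_iff R p _).2 hp]
    exact ⟨D w * r, by ring⟩
  · obtain ⟨r', rfl⟩ := hr q hq ((dvd_pow_self q hpos.ne').trans (hw ▸ dvd_mul_right _ _)) hp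
    rw [hD]
    have hpow : q ^ e = q ^ (e - 1) * q := by rw [← pow_succ, Nat.sub_add_cancel hpos]
    rw [hpow]
    exact ⟨q * D w * r' + w * e * D q * r', by ring⟩

/-- A prime `h` with `h ∤ D h` and `p ∤ mult_h(u)` divides the denominator of `D u / u`. -/
theorem not_dvd_of_derivation_mul_eq {R : Type*} [CommRing R] [IsDomain R]
    [UniqueFactorizationMonoid R] (p : ℕ) [Fact p.Prime] [CharP R p] (D : R →+ R)
    (hDmul : ∀ a b, D (a * b) = a * D b + b * D a)
    {u r N h : R} (hu : u ≠ 0) (hh : Prime h) (hD : ¬ h ∣ D h) (hp : ¬ p ∣ multiplicity h u)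
    (hr : h ∣ r) (hr2 : ¬ h * h ∣ r) (hN : D u * r = u * N) : ¬ h ∣ N := by
  obtain ⟨w, hw, hqw⟩ := exists_eq_pow_multiplicity_mul hh hu
  set e := multiplicity h u with he
  have hpos : 0 < e := Nat.pos_of_ne_zero fun h0 => hp (h0 ▸ dvd_zero p)
  obtain ⟨r', rfl⟩ := hr
  have hr' : ¬ h ∣ r' := fun hd => hr2 (mul_dvd_mul_left h hd)
  have hD' : D u = h ^ e * D w + w * ((e : R) * h ^ (e - 1) * D h) := by
    conv_lhs => rw [hw]
    rw [hDmul, leibniz_pow_of_leibniz D hDmul]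
  have hpow : h ^ e = h ^ (e - 1) * h := by rw [← pow_succ, Nat.sub_add_cancel hpos]
  -- This is `D u * r = u * N` after cancelling `h ^ e`. Modulo `h` it reads `e * w * D h * r' = w *
  -- N`, where `e` is a unit and `h` divides none of `w`, `D h`, `r'`.
  have key : h * D w * r' + (e : R) * (w * D h * r') = w * N := by
    have h1 : h ^ e ≠ 0 := pow_ne_zero _ hh.ne_zero
    refine mul_left_cancel₀ h1 ?_
    calc h ^ e * (h * D w * r' + e * (w * D h * r'))
        = (h ^ e * D w + w * (e * h ^ (e - 1) * D h)) * (h * r') := by rw [hpow]; ring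
      _ = u * N := by rw [← hD', hN]
      _ = h ^ e * (w * N) := by conv_lhs => rw [hw]
                                ring
  rintro ⟨N', rfl⟩
  have hu' : IsUnit (e : R) := by
    have hcop : IsCoprime (e : ℤ) (p : ℤ) := by
      rw [Nat.isCoprime_iff_coprime]
      exact ((Nat.Prime.coprime_iff_not_dvd Fact.out).2 hp).symm
    obtain ⟨a, b, hab⟩ := hcop
    have h2 := congrArg (Int.cast : ℤ → R) hab
    push_cast at h2
    rw [CharP.cast_eq_zero R p, mul_zero, add_zero] at h2
    exact IsUnit.of_mul_eq_one_right _ h2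
  have h3 : h ∣ (e : R) * (w * D h * r') :=
    ⟨w * N' - D w * r', by linear_combination key⟩
  rw [hu'.dvd_mul_left] at h3
  exact (hh.dvd_or_dvd h3).elim (fun h4 => (hh.dvd_or_dvd h4).elim hqw hD) hr'

open MvPolynomial

section PartialRadical

variable {n : ℕ} {F : Type*} [Field F] {p : ℕ} {u : MvPolynomial (Fin n) F}

theorem partialRadical_ne_zero (u : MvPolynomial (Fin n) F) : partialRadical p u ≠ 0 := by
  classical
  let : StrongNormalizationMonoid (MvPolynomial (Fin n) F) :=
    UniqueFactorizationMonoid.strongNormalizationMonoid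
  refine Finset.prod_ne_zero_iff.2 fun h hh => ?_
  exact (irreducible_of_normalized_factor h (Multiset.mem_toFinset.1 (Finset.mem_filter.1 hh).1)).ne_zero

theorem dvd_partialRadical (hu : u ≠ 0) {q : MvPolynomial (Fin n) F} (hq : Prime q) (hqu : q ∣ u)
    (hp : ¬ p ∣ multiplicity q u) : q ∣ partialRadical p u := by
  classical
  let : StrongNormalizationMonoid (MvPolynomial (Fin n) F) :=
    UniqueFactorizationMonoid.strongNormalizationMonoid
  obtain ⟨h, hh, hqh⟩ := exists_mem_normalizedFactors_of_dvd hu hq.irreducible hqu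
  rw [← multiplicity_eq_of_associated_left hqh] at hp
  exact hqh.dvd.trans (Finset.dvd_prod_of_mem _ (Finset.mem_filter.2
    ⟨Multiset.mem_toFinset.2 hh, hp⟩))

/-- A prime divisor of the product is associate to one of its factors. Associate normalized factors
are equal, so no second factor of the product is divisible by `h`. -/
theorem not_dvd_multiplicity_of_dvd_partialRadical {h : MvPolynomial (Fin n) F} (hh : Prime h)
    (hr : h ∣ partialRadical p u) :
    ¬ p ∣ multiplicity h u ∧ ¬ h * h ∣ partialRadical p u := by
  classical
  let : StrongNormalizationMonoid (MvPolynomial (Fin n) F) :=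
    UniqueFactorizationMonoid.strongNormalizationMonoid
  have key : ∀ q ∈ {q ∈ (normalizedFactors u).toFinset | ¬ p ∣ multiplicity q u},
      q ∈ normalizedFactors u ∧ ¬ p ∣ multiplicity q u := fun q hq =>
    ⟨Multiset.mem_toFinset.1 (Finset.mem_filter.1 hq).1, (Finset.mem_filter.1 hq).2⟩
  obtain ⟨q, hq, hhq⟩ := (hh.dvd_finsetProd_iff _).1 hr
  have hass : Associated h q :=
    hh.irreducible.associated_of_dvd (irreducible_of_normalized_factor q (key q hq).1) hhq
  refine ⟨?_, fun hd => ?_⟩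
  · rw [← multiplicity_eq_of_associated_left hass]
    exact (key q hq).2
  · have h1 : q * h ∣ q * ∏ q' ∈ Finset.erase {q ∈ (normalizedFactors u).toFinset |
        ¬ p ∣ multiplicity q u} q, q' := by
      rw [Finset.mul_prod_erase _ (fun q => q) hq]
      exact (mul_dvd_mul_right hass.symm.dvd h).trans hd
    have h2 := (mul_dvd_mul_iff_left
      (irreducible_of_normalized_factor q (key q hq).1).ne_zero).1 h1
    obtain ⟨q', hq', hhq'⟩ := (hh.dvd_finsetProd_iff _).1 h2
    have hmem := key q' (Finset.mem_of_mem_erase hq')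
    have hass' : Associated h q' :=
      hh.irreducible.associated_of_dvd (irreducible_of_normalized_factor q' hmem.1) hhq'
    refine Finset.ne_of_mem_erase hq' ?_
    rw [← normalize_normalized_factor q' hmem.1, ← normalize_normalized_factor q (key q hq).1]
    exact normalize_eq_normalize (hass'.symm.trans hass).dvd (hass.symm.trans hass').dvd

/-- An irreducible factor `h` of the partial radical of `u₁` is a factor, coprime to its cofactor,
of the denominator of a reduced fraction of small degree that equals a quotient of polynomials that
are differential expressions in `u₀ * u₁` and `u₀`. -/
theorem exists_reduced_fraction [Fact p.Prime] [CharP F p] {u₀ u₁ h : MvPolynomial (Fin n) F}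
    (hu : u₁ ≠ 0) (hh : Irreducible h) (hr : h ∣ partialRadical p u₁) :
    ∃ (D : MvPolynomial (Fin n) F →+ MvPolynomial (Fin n) F) (h' N : MvPolynomial (Fin n) F),
      (∀ P Q, D (P * Q) = P * D Q + Q * D P) ∧
      (∀ c, ∃ c', D (C c) = C c') ∧ (∀ i, ∃ c', D (X i) = C c') ∧
      IsRelPrime h h' ∧ IsRelPrime (h * h') N ∧ h * h' ≠ 0 ∧
      (D (u₀ * u₁) * u₀ - u₀ * u₁ * D u₀) * (h * h') = (u₀ * u₁ * u₀) * N ∧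
      (h * h').totalDegree ≤ (partialRadical p u₁).totalDegree ∧
      N.totalDegree ≤ (h * h').totalDegree := by
  obtain ⟨D, hDmul, hDh, hDC, hDX, hDdeg⟩ := exists_derivation_not_dvd p h hh
  have hr0 := partialRadical_ne_zero (p := p) u₁
  obtain ⟨hmult, hsq⟩ := not_dvd_multiplicity_of_dvd_partialRadical hh.prime hr
  have hdvd : u₁ ∣ D u₁ * partialRadical p u₁ :=
    dvd_derivation_mul p D hDmul hu fun q hq h1 h2 => dvd_partialRadical hu hq h1 h2
  generalize partialRadical p u₁ = r at *
  obtain ⟨N₀, hN₀⟩ := hdvd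
  have hhN := not_dvd_of_derivation_mul_eq p D hDmul hu hh.prime hDh hmult hr hsq hN₀
  have hN0 : N₀ ≠ 0 := fun h0 => hhN (h0 ▸ dvd_zero h)
  -- The derivation does not raise degrees, so in `D u₁ * r = u₁ * N₀` the degree of `N₀` is at most
  -- that of `r`, however large `u₁` is.
  have hdegN : N₀.totalDegree ≤ r.totalDegree := by
    have hDu : D u₁ ≠ 0 := fun h0 => by
      rw [h0, zero_mul] at hN₀
      exact mul_ne_zero hu hN0 hN₀.symm
    have h1 := congrArg totalDegree hN₀
    rw [totalDegree_mul_of_isDomain hDu hr0, totalDegree_mul_of_isDomain hu hN0] at h1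
    have := hDdeg u₁
    omega
  -- Cancelling the common factor `c` of `r` and `N₀` leaves `h` in the denominator, because `h ∤
  -- N₀`.
  obtain ⟨r₁, N, c, hrel, hcr, hcN⟩ := exists_reduced_factors' r N₀ hN0
  have hc0 : c ≠ 0 := by rintro rfl; exact hr0 (by rw [← hcr, zero_mul])
  have hr₁0 : r₁ ≠ 0 := by rintro rfl; exact hr0 (by rw [← hcr, mul_zero])
  have hN10 : N ≠ 0 := by rintro rfl; exact hN0 (by rw [← hcN, mul_zero])
  obtain ⟨h', rfl⟩ : h ∣ r₁ := by
    rw [← hcr] at hr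
    exact (hh.prime.dvd_or_dvd hr).resolve_left fun hd => hhN (hcN ▸ hd.mul_right _)
  refine ⟨D, h', N, hDmul, hDC, hDX, ?_, hrel, hr₁0, ?_, ?_, ?_⟩
  · rw [hh.isRelPrime_iff_not_dvd]
    exact fun hd => hsq ((mul_dvd_mul_left h hd).trans (hcr ▸ dvd_mul_left _ _))
  · refine mul_left_cancel₀ hc0 ?_
    have h1 : D (u₀ * u₁) * u₀ - u₀ * u₁ * D u₀ = u₀ * u₀ * D u₁ := by
      rw [hDmul]; ring
    rw [h1]
    calc c * (u₀ * u₀ * D u₁ * (h * h')) = u₀ * u₀ * (D u₁ * r) := by rw [← hcr]; ring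
      _ = c * (u₀ * u₁ * u₀ * N) := by rw [hN₀, ← hcN]; ring
  · rw [← hcr, totalDegree_mul_of_isDomain hc0 hr₁0]
    exact Nat.le_add_left _ _
  · rw [← hcr, ← hcN, totalDegree_mul_of_isDomain hc0 hr₁0, totalDegree_mul_of_isDomain hc0 hN10]
      at hdegN
    omega

end PartialRadical

end LogDerivative

/-! ### Coprime polynomials on generic lines -/

section GenericLine

namespace Polynomial

open IsLocalization

/-- **Gauss's lemma**: coprime polynomials over a factorial ring satisfy a Bézout identity with a
nonzero constant. -/
theorem exists_bezout_of_isRelPrime {A : Type*} [CommRing A] [IsDomain A]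
    [UniqueFactorizationMonoid A] {f g : Polynomial A} (h : IsRelPrime f g) :
    ∃ (c : A) (U V : Polynomial A), c ≠ 0 ∧ U * f + V * g = C c := by
  classical
  obtain ⟨_⟩ : Nonempty (NormalizedGCDMonoid A) := inferInstance
  let K := FractionRing A
  have hinj : Function.Injective (algebraMap A K) := IsFractionRing.injective A K
  have hmapinj := Polynomial.map_injective _ hinj
  have hnorm : ∀ d : Polynomial K, ∃ (b : A) (d₀ : Polynomial A), b ≠ 0 ∧
      d₀.map (algebraMap A K) = C (algebraMap A K b) * d := by
    intro d
    obtain ⟨b, hbm, hb⟩ := integerNormalization_spec (nonZeroDivisors A) d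
    refine ⟨b, _, nonZeroDivisors.ne_zero hbm, hb.trans ?_⟩
    rw [← algebraMap_smul K, smul_eq_C_mul]
  have hC : ∀ b : A, b ≠ 0 → IsUnit (C (algebraMap A K b)) := fun b hb =>
    isUnit_C.2 (IsUnit.mk0 _ ((map_ne_zero_iff _ hinj).2 hb))
  have hcop : IsCoprime (f.map (algebraMap A K)) (g.map (algebraMap A K)) := by
    refine IsRelPrime.isCoprime fun d hdf hdg => ?_
    obtain ⟨b, d₀, hb, hd₀⟩ := hnorm d
    have hd0 : d ≠ 0 := by
      rintro rfl
      rw [zero_dvd_iff, Polynomial.map_eq_zero_iff hinj] at hdf hdg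
      subst hdf hdg
      exact not_isUnit_zero (h dvd_rfl dvd_rfl)
    have hd₀0 : d₀ ≠ 0 := by
      rintro rfl
      rw [Polynomial.map_zero] at hd₀
      exact (mul_ne_zero (hC b hb).ne_zero hd0) hd₀.symm
    -- A common divisor over `K` has a primitive representative over `A`. For a primitive
    -- polynomial, divisibility over `K` implies divisibility over `A`, so coprimality passes to
    -- `K[X]`, which has Bézout identities.
    have hass : Associated (d₀.primPart.map (algebraMap A K)) d := by
      have h1 := d₀.eq_C_content_mul_primPart
      have h2 := congrArg (Polynomial.map (algebraMap A K)) h1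
      rw [Polynomial.map_mul, map_C, hd₀] at h2
      have hc := hC _ (mt content_eq_zero_iff.1 hd₀0)
      exact (associated_isUnit_mul_left_iff hc).1
        (h2 ▸ (associated_isUnit_mul_left_iff (hC b hb)).2 (Associated.refl d))
    have hunit := h (d₀.isPrimitive_primPart.dvd_of_fraction_map_dvd_fraction_map
        (hass.dvd.trans hdf))
      (d₀.isPrimitive_primPart.dvd_of_fraction_map_dvd_fraction_map (hass.dvd.trans hdg))
    exact hass.isUnit (hunit.map (mapRingHom (algebraMap A K)))
  obtain ⟨U, V, hUV⟩ := hcop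
  obtain ⟨b, U₀, hb, hU⟩ := hnorm U
  obtain ⟨c, V₀, hc, hV⟩ := hnorm V
  refine ⟨b * c, C c * U₀, C b * V₀, mul_ne_zero hb hc, hmapinj ?_⟩
  simp only [Polynomial.map_add, Polynomial.map_mul, map_C, hU, hV, map_mul]
  linear_combination (C (algebraMap A K b) * C (algebraMap A K c)) * hUV

end Polynomial

namespace MvPolynomial

variable {σ F : Type*}

/-- The restriction of a polynomial to the line `y ↦ a + y b`. -/
noncomputable def restrictLine [CommSemiring F] {A : Type*} [CommSemiring A] (φ : F →+* A)
    (a b : σ → A) : MvPolynomial σ F →+* Polynomial A :=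
  eval₂Hom (Polynomial.C.comp φ) fun i => Polynomial.C (a i) + Polynomial.C (b i) * Polynomial.X

theorem map_restrictLine [CommSemiring F] {A B : Type*} [CommSemiring A] [CommSemiring B]
    (φ : F →+* A) (ψ : A →+* B) (a b : σ → A) (P : MvPolynomial σ F) :
    (restrictLine φ a b P).map ψ =
      restrictLine (ψ.comp φ) (fun i => ψ (a i)) (fun i => ψ (b i)) P := by
  change Polynomial.mapRingHom ψ (eval₂Hom _ _ P) = _
  rw [map_eval₂Hom]
  refine congrArg (fun f : MvPolynomial σ F →+* Polynomial B => f P) (ringHom_ext ?_ ?_) <;>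
    simp [restrictLine]

theorem eval_zero_restrictLine [CommSemiring F] {A : Type*} [CommSemiring A] (φ : F →+* A)
    (a b : σ → A) (P : MvPolynomial σ F) : (restrictLine φ a b P).eval 0 = eval₂ φ a P := by
  change Polynomial.evalRingHom 0 (eval₂Hom _ _ P) = _
  rw [map_eval₂Hom]
  refine congrArg (fun f : MvPolynomial σ F →+* A => f P)
    (show _ = eval₂Hom φ a from ringHom_ext ?_ ?_) <;> simp

/-- The restriction of `P` to a line has degree at most `totalDegree P`, and the coefficient in
this degree is the value at the direction of the line of the leading form of `P`. -/
theorem restrictLine_natDegree_le_and_coeff [CommSemiring F] {A : Type*} [CommSemiring A]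
    (φ : F →+* A) (a b : σ → A) (P : MvPolynomial σ F) :
    (restrictLine φ a b P).natDegree ≤ P.totalDegree ∧
      (restrictLine φ a b P).coeff P.totalDegree =
        eval₂ φ b (homogeneousComponent P.totalDegree P) := by
  classical
  have hprod : ∀ α : σ →₀ ℕ, (α.prod fun i e =>
      (Polynomial.C (a i) + Polynomial.C (b i) * Polynomial.X) ^ e).natDegree ≤ α.degree ∧
      (α.prod fun i e => (Polynomial.C (a i) + Polynomial.C (b i) * Polynomial.X) ^ e).coeff
        α.degree = α.prod fun i e => b i ^ e := by
    intro α
    have hlin : ∀ i, (Polynomial.C (a i) + Polynomial.C (b i) * Polynomial.X).natDegree ≤ 1 :=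
      fun i => by compute_degree
    have hpow : ∀ i e, ((Polynomial.C (a i) + Polynomial.C (b i) * Polynomial.X) ^ e).natDegree
        ≤ e := fun i e => (Polynomial.natDegree_pow_le_of_le e (hlin i)).trans_eq (mul_one e)
    have hco : ∀ i e, ((Polynomial.C (a i) + Polynomial.C (b i) * Polynomial.X) ^ e).coeff e
        = b i ^ e := fun i e => by
      have h1 := Polynomial.coeff_pow_of_natDegree_le (m := e) (hlin i)
      rw [mul_one] at h1
      rw [h1]; simp [Polynomial.coeff_C]
    have key : ∀ s : Finset σ, (∏ i ∈ s, (Polynomial.C (a i) + Polynomial.C (b i) *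
        Polynomial.X) ^ α i).natDegree ≤ ∑ i ∈ s, α i ∧
        (∏ i ∈ s, (Polynomial.C (a i) + Polynomial.C (b i) * Polynomial.X) ^ α i).coeff
          (∑ i ∈ s, α i) = ∏ i ∈ s, b i ^ α i := by
      intro s
      induction s using Finset.induction_on with
      | empty => simp
      | insert i s hi ih =>
        rw [Finset.prod_insert hi, Finset.sum_insert hi, Finset.prod_insert hi]
        exact ⟨Polynomial.natDegree_mul_le_of_le (hpow i _) ih.1, by
          rw [Polynomial.coeff_mul_add_eq_of_natDegree_le (hpow i _) ih.1, hco, ih.2]⟩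
    exact key α.support
  have hexp : restrictLine φ a b P = ∑ α ∈ P.support, Polynomial.C (φ (coeff α P)) *
      α.prod fun i e => (Polynomial.C (a i) + Polynomial.C (b i) * Polynomial.X) ^ e := by
    conv_lhs => rw [P.as_sum]
    rw [map_sum]
    exact Finset.sum_congr rfl fun α _ => eval₂Hom_monomial _ _ _ _
  constructor
  · rw [hexp]
    refine Polynomial.natDegree_sum_le_of_forall_le _ _ fun α hα => ?_
    refine (Polynomial.natDegree_C_mul_le _ _).trans ((hprod α).1.trans ?_)
    exact le_totalDegree hα
  · rw [hexp, Polynomial.finsetSum_coeff, homogeneousComponent_apply, eval₂_sum,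
      Finset.sum_filter]
    refine Finset.sum_congr rfl fun α hα => ?_
    rw [Polynomial.coeff_C_mul]
    split_ifs with hd
    · rw [eval₂_monomial, ← hd, (hprod α).2]
    · rw [Polynomial.coeff_eq_zero_of_natDegree_lt, mul_zero]
      exact (hprod α).1.trans_lt (lt_of_le_of_ne (le_totalDegree hα) hd)

section Field

variable [Field F]

/-- A divisor of a nonzero polynomial free of the new variables has degree zero in each of them, so
new variables create no new common divisors. -/
theorem isRelPrime_rename_inl {τ : Type*} {P Q : MvPolynomial σ F} (h : IsRelPrime P Q) :
    IsRelPrime (rename Sum.inl P : MvPolynomial (σ ⊕ τ) F) (rename Sum.inl Q) := by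
  have hinj := rename_injective (R := F) (Sum.inl : σ → σ ⊕ τ) Sum.inl_injective
  have key : ∀ (d : MvPolynomial (σ ⊕ τ) F) (P : MvPolynomial σ F), P ≠ 0 →
      d ∣ rename Sum.inl P → ∃ d₀, d = rename Sum.inl d₀ := by
    classical
    rintro d P hP ⟨e, he⟩
    have hne : d * e ≠ 0 := by
      rw [← he]; exact (map_ne_zero_iff _ hinj).2 hP
    obtain ⟨d₀, rfl⟩ := exists_rename_eq_of_vars_subset_range d (Sum.inl : σ → σ ⊕ τ)
      Sum.inl_injective fun v hv => by
        rcases v with v | v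
        · exact ⟨v, rfl⟩
        · have h1 : degreeOf (Sum.inr v) (rename (Sum.inl : σ → σ ⊕ τ) P) = 0 := by
            refine not_not.1 fun hne => ?_
            have hmem := mem_vars_iff_degreeOf_ne_zero.2 hne
            obtain ⟨w, -, hw⟩ := Finset.mem_image.1 (vars_rename _ _ hmem)
            exact Sum.inl_ne_inr hw
          rw [he, degreeOf_mul_eq (left_ne_zero_of_mul hne) (right_ne_zero_of_mul hne)] at h1
          exact absurd (mem_vars_iff_degreeOf_ne_zero.1 hv) (by omega)
    exact ⟨d₀, rfl⟩
  have hdvd : ∀ d₀ P : MvPolynomial σ F,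
      (rename Sum.inl d₀ : MvPolynomial (σ ⊕ τ) F) ∣ rename Sum.inl P → d₀ ∣ P := by
    intro d₀ P hd
    have := map_dvd (killCompl (R := F) (Sum.inl_injective (α := σ) (β := τ))) hd
    rwa [killCompl_rename_app, killCompl_rename_app] at this
  intro d hP hQ
  obtain ⟨d₀, rfl⟩ : ∃ d₀, d = rename Sum.inl d₀ := by
    rcases h.ne_zero_or_ne_zero with h0 | h0
    · exact key d P h0 hP
    · exact key d Q h0 hQ
  exact (h (hdvd _ _ hP) (hdvd _ _ hQ)).map (rename Sum.inl)

/-- The endomorphism of `F[a, b][y]` that maps `a` to `a + s b` and fixes `b` and `y`. -/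
noncomputable def lineShift (s : Polynomial (MvPolynomial (σ ⊕ σ) F)) :
    Polynomial (MvPolynomial (σ ⊕ σ) F) →+* Polynomial (MvPolynomial (σ ⊕ σ) F) :=
  Polynomial.eval₂RingHom (eval₂Hom (Polynomial.C.comp C) (Sum.elim
    (fun i => Polynomial.C (X (Sum.inl i)) + s * Polynomial.C (X (Sum.inr i)))
    (fun i => Polynomial.C (X (Sum.inr i))))) Polynomial.X

/-- Coprime polynomials stay coprime on the generic line. -/
theorem isRelPrime_restrictLine {P Q : MvPolynomial σ F} (h : IsRelPrime P Q) :
    IsRelPrime (restrictLine (A := MvPolynomial (σ ⊕ σ) F) C (fun i => X (Sum.inl i))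
        (fun i => X (Sum.inr i)) P)
      (restrictLine C (fun i => X (Sum.inl i)) (fun i => X (Sum.inr i)) Q) := by
  -- The shift `a ↦ a - y b` is undone by `a ↦ a + y b`. It carries the restriction of `P` to the
  -- generic line to `P(a)`, which is constant in `y`; a common divisor is then constant in `y` too,
  -- and a unit.
  have hcomp : (lineShift (σ := σ) (F := F) Polynomial.X).comp (lineShift (-Polynomial.X)) = RingHom.id _ := by
    refine Polynomial.ringHom_ext' (ringHom_ext ?_ ?_) ?_
    · intro r; simp [lineShift]
    · rintro (i | i)
      · simp [lineShift]; ring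
      · simp [lineShift]
    · simp [lineShift]
  have hline : ∀ P : MvPolynomial σ F, lineShift (-Polynomial.X) (restrictLine C
      (fun i => X (Sum.inl i)) (fun i => X (Sum.inr i)) P) =
        Polynomial.C (rename Sum.inl P) := by
    intro P
    change ((lineShift (-Polynomial.X)).comp (restrictLine C (fun i => X (Sum.inl i))
      (fun i => X (Sum.inr i)))) P = (Polynomial.C.comp (rename Sum.inl).toRingHom) P
    refine congrArg (fun f : MvPolynomial σ F →+* Polynomial (MvPolynomial (σ ⊕ σ) F) => f P) (ringHom_ext ?_ ?_)
    · intro r; simp [lineShift, restrictLine]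
    · intro i; simp [lineShift, restrictLine]; ring
  have hrel := isRelPrime_rename_inl (τ := σ) h
  intro d hdP hdQ
  have h1 := map_dvd (lineShift (-Polynomial.X)) hdP
  have h2 := map_dvd (lineShift (-Polynomial.X)) hdQ
  rw [hline] at h1 h2
  have hC : ∃ c : MvPolynomial (σ ⊕ σ) F, lineShift (-Polynomial.X) d = Polynomial.C c := by
    have aux : ∀ {e : Polynomial (MvPolynomial (σ ⊕ σ) F)} {c : MvPolynomial (σ ⊕ σ) F}, c ≠ 0 → e ∣ Polynomial.C c →
        ∃ c', e = Polynomial.C c' := fun {e c} hc he => by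
      have h3 := Polynomial.natDegree_le_of_dvd he (Polynomial.C_ne_zero.2 hc)
      rw [Polynomial.natDegree_C] at h3
      exact ⟨_, Polynomial.eq_C_of_natDegree_le_zero h3⟩
    rcases hrel.ne_zero_or_ne_zero with h0 | h0
    · exact aux h0 h1
    · exact aux h0 h2
  obtain ⟨c, hc⟩ := hC
  rw [hc] at h1 h2
  have hunit : IsUnit c := hrel
    (by obtain ⟨e, he⟩ := h1
        exact ⟨e.coeff 0, by rw [← Polynomial.coeff_C_mul, ← he, Polynomial.coeff_C_zero]⟩)
    (by obtain ⟨e, he⟩ := h2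
        exact ⟨e.coeff 0, by rw [← Polynomial.coeff_C_mul, ← he, Polynomial.coeff_C_zero]⟩)
  have h4 : IsUnit (lineShift (-Polynomial.X) d) := hc ▸ hunit.map Polynomial.C
  have h5 := h4.map (lineShift Polynomial.X)
  have h6 : lineShift Polynomial.X (lineShift (-Polynomial.X) d) = d := RingHom.congr_fun hcomp d
  rwa [h6] at h5

/-- Coprime polynomials stay coprime on the lines outside a hypersurface. -/
theorem exists_isCoprime_restrictLine {K : Type*} [Field K] (φ : F →+* K)
    {P Q : MvPolynomial σ F} (h : IsRelPrime P Q) :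
    ∃ Φ : MvPolynomial (σ ⊕ σ) F, Φ ≠ 0 ∧ ∀ a b : σ → K,
      eval₂ φ (Sum.elim a b) Φ ≠ 0 →
        IsCoprime (restrictLine φ a b P) (restrictLine φ a b Q) := by
  obtain ⟨Φ, U, V, hΦ, hUV⟩ := Polynomial.exists_bezout_of_isRelPrime (isRelPrime_restrictLine h)
  refine ⟨Φ, hΦ, fun a b hne => ?_⟩
  have hspec : ∀ P : MvPolynomial σ F, (restrictLine (A := MvPolynomial (σ ⊕ σ) F) C
      (fun i => X (Sum.inl i)) (fun i => X (Sum.inr i)) P).map (eval₂Hom φ (Sum.elim a b)) =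
        restrictLine φ a b P := by
    intro P
    rw [map_restrictLine]
    refine congrArg (fun f : MvPolynomial σ F →+* Polynomial K => f P) (ringHom_ext ?_ ?_) <;>
      simp [restrictLine]
  have h1 := congrArg (Polynomial.map (eval₂Hom φ (Sum.elim a b))) hUV
  rw [Polynomial.map_add, Polynomial.map_mul, Polynomial.map_mul, hspec, hspec,
    Polynomial.map_C] at h1
  refine ⟨Polynomial.C (eval₂ φ (Sum.elim a b) Φ)⁻¹ * U.map (eval₂Hom φ (Sum.elim a b)),
    Polynomial.C (eval₂ φ (Sum.elim a b) Φ)⁻¹ * V.map (eval₂Hom φ (Sum.elim a b)), ?_⟩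
  rw [mul_assoc, mul_assoc, ← mul_add, h1, ← Polynomial.C_mul]
  simp [hne]

/-- There are lines over an infinite extension field on which finitely many nonvanishing and
coprimality conditions hold simultaneously. -/
theorem exists_line {K : Type*} [Field K] [Infinite K] (φ : F →+* K)
    {P Q G H B T : MvPolynomial σ F} (hPQ : IsRelPrime P Q) (hGH : IsRelPrime G H) (hB : B ≠ 0)
    (hT : T ≠ 0) : ∃ a b : σ → K, IsCoprime (restrictLine φ a b P) (restrictLine φ a b Q) ∧
      IsCoprime (restrictLine φ a b G) (restrictLine φ a b H) ∧ eval₂ φ a B ≠ 0 ∧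
        eval₂ φ b T ≠ 0 := by
  obtain ⟨Φ, hΦ, hΦ'⟩ := exists_isCoprime_restrictLine φ hPQ
  obtain ⟨Ψ, hΨ, hΨ'⟩ := exists_isCoprime_restrictLine φ hGH
  have hB' : rename Sum.inl B ≠ (0 : MvPolynomial (σ ⊕ σ) F) :=
    (map_ne_zero_iff _ (rename_injective _ Sum.inl_injective)).2 hB
  have hT' : rename Sum.inr T ≠ (0 : MvPolynomial (σ ⊕ σ) F) :=
    (map_ne_zero_iff _ (rename_injective _ Sum.inr_injective)).2 hT
  -- All four conditions are the nonvanishing of one nonzero polynomial in `(a, b)`, which has a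
  -- non-root over the infinite field `K`.
  have hne : map φ (Φ * Ψ * rename Sum.inl B * rename Sum.inr T) ≠ 0 :=
    (map_ne_zero_iff _ (map_injective φ φ.injective)).2
      (mul_ne_zero (mul_ne_zero (mul_ne_zero hΦ hΨ) hB') hT')
  obtain ⟨z, hz⟩ : ∃ z, eval z (map φ (Φ * Ψ * rename Sum.inl B * rename Sum.inr T)) ≠ 0 := by
    by_contra! hcon
    exact hne (funext fun z => by rw [hcon, map_zero])
  have hz' : Sum.elim (z ∘ Sum.inl) (z ∘ Sum.inr) = z := Sum.elim_comp_inl_inr z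
  rw [eval_map, eval₂_mul, eval₂_mul, eval₂_mul, eval₂_rename, eval₂_rename] at hz
  refine ⟨z ∘ Sum.inl, z ∘ Sum.inr, hΦ' _ _ ?_, hΨ' _ _ ?_, ?_, ?_⟩
  · rw [hz']; exact fun h => hz (by rw [h]; ring)
  · rw [hz']; exact fun h => hz (by rw [h]; ring)
  · exact fun h => hz (by rw [h]; ring)
  · exact fun h => hz (by rw [h]; ring)

end Field

end MvPolynomial

end GenericLine

/-! ### Straight-line programs -/

section StraightLine

open MvPolynomial

/-- `FormulaCost S m q`: the polynomial `q` is computed from the elements of `S`, constants and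
variables by a formula with at most `m` leaves outside `S` and binary operations. -/
inductive FormulaCost {n : ℕ} {F : Type*} [CommSemiring F] (S : Set (MvPolynomial (Fin n) F)) :
    ℕ → MvPolynomial (Fin n) F → Prop where
  | mem {m q} (h : q ∈ S) : FormulaCost S m q
  | const {m} (c : F) : FormulaCost S (m + 1) (C c)
  | var {m} (i : Fin n) : FormulaCost S (m + 1) (X i)
  | add {a b m q r} (hq : FormulaCost S a q) (hr : FormulaCost S b r) (h : a + b + 1 ≤ m) :
      FormulaCost S m (q + r)
  | mul {a b m q r} (hq : FormulaCost S a q) (hr : FormulaCost S b r) (h : a + b + 1 ≤ m) :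
      FormulaCost S m (q * r)

/-- `StraightLine m S`: the polynomials in `S` are the results of a straight-line program with at
most `m` instructions. -/
inductive StraightLine {n : ℕ} {F : Type*} [CommSemiring F] :
    ℕ → Set (MvPolynomial (Fin n) F) → Prop where
  | nil {m} : StraightLine m ∅
  | step {m S q} (hS : StraightLine m S) (hq : FormulaCost S 1 q) :
      StraightLine (m + 1) (insert q S)

variable {n : ℕ} {F : Type*} [CommSemiring F] {S T : Set (MvPolynomial (Fin n) F)}
  {q : MvPolynomial (Fin n) F} {m m' a : ℕ}

namespace FormulaCost

theorem mono (h : FormulaCost S a q) (hST : S ⊆ T) : FormulaCost T a q := by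
  induction h with
  | mem h => exact mem (hST h)
  | const c => exact const c
  | var i => exact var i
  | add _ _ h h₁ h₂ => exact add h₁ h₂ h
  | mul _ _ h h₁ h₂ => exact mul h₁ h₂ h

theorem mono_cost (h : FormulaCost S m q) (hm : m ≤ m') : FormulaCost S m' q := by
  cases h with
  | mem h => exact mem h
  | const c => obtain ⟨k, rfl⟩ := Nat.exists_eq_add_of_le' (Nat.one_le_of_lt hm); exact const c
  | var i => obtain ⟨k, rfl⟩ := Nat.exists_eq_add_of_le' (Nat.one_le_of_lt hm); exact var i
  | add h₁ h₂ h => exact add h₁ h₂ (h.trans hm)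
  | mul h₁ h₂ h => exact mul h₁ h₂ (h.trans hm)

/-- Only members of `S` are free. Hence the operands of an instruction of cost one are results
already present. -/
theorem mem_of_zero (h : FormulaCost S 0 q) : q ∈ S := by
  cases h with
  | mem h => exact h
  | add _ _ h => omega
  | mul _ _ h => omega

theorem listSum (l : List (MvPolynomial (Fin n) F)) (hl : ∀ q ∈ l, q ∈ S) :
    FormulaCost S (1 + l.length) l.sum := by
  induction l with
  | nil => simpa using const (m := 0) (S := S) (0 : F)
  | cons q l ih =>
    rw [List.sum_cons]
    exact add (mem (m := 0) (hl q (by simp))) (ih fun r hr => hl r (by simp [hr]))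
      (by simp)

theorem listProd (l : List (MvPolynomial (Fin n) F)) (hl : ∀ q ∈ l, q ∈ S) :
    FormulaCost S (1 + l.length) l.prod := by
  induction l with
  | nil => simpa using const (m := 0) (S := S) (1 : F)
  | cons q l ih =>
    rw [List.prod_cons]
    exact mul (mem (m := 0) (hl q (by simp))) (ih fun r hr => hl r (by simp [hr]))
      (by simp)

theorem sum {ι : Type*} (s : Finset ι) (f : ι → MvPolynomial (Fin n) F)
    (hf : ∀ i ∈ s, FormulaCost S a (f i)) :
    FormulaCost S (s.card * (a + 1) + 1) (∑ i ∈ s, f i) := by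
  classical
  induction s using Finset.induction_on with
  | empty => simpa using const (m := 0) (S := S) (0 : F)
  | insert i s hi ih =>
    rw [Finset.sum_insert hi, Finset.card_insert_of_notMem hi]
    exact add (hf i (by simp)) (ih fun j hj => hf j (by simp [hj])) (by nlinarith)

end FormulaCost

namespace StraightLine

theorem mono (h : StraightLine m S) (hm : m ≤ m') : StraightLine m' S := by
  induction h generalizing m' with
  | nil => exact nil
  | step _ hq ih =>
    obtain ⟨k, rfl⟩ := Nat.exists_eq_add_of_le' (Nat.one_le_of_lt hm)
    exact step (ih (by omega)) hq

/-- The formula is compiled operation by operation. The induction ranges over all programs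
containing `S`, since the second operand is compiled after the results for the first have been
added. -/
theorem extend (h : StraightLine m S) (hq : FormulaCost S a q) :
    ∃ S', S ⊆ S' ∧ q ∈ S' ∧ StraightLine (m + a) S' := by
  suffices H : ∀ T m, S ⊆ T → StraightLine m T →
      ∃ S', T ⊆ S' ∧ q ∈ S' ∧ StraightLine (m + a) S' from H S m subset_rfl h
  clear h
  induction hq with
  | mem h => exact fun T m hT h' => ⟨T, subset_rfl, hT h, h'.mono (by omega)⟩
  | const c =>
    exact fun T m hT h' => ⟨_, Set.subset_insert _ _, Set.mem_insert _ _,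
      (h'.step (FormulaCost.const c)).mono (by omega)⟩
  | var i =>
    exact fun T m hT h' => ⟨_, Set.subset_insert _ _, Set.mem_insert _ _,
      (h'.step (FormulaCost.var i)).mono (by omega)⟩
  | add _ _ h h₁ h₂ =>
    intro T m hT h'
    obtain ⟨T₁, hT₁, hq₁, hS₁⟩ := h₁ T m hT h'
    obtain ⟨T₂, hT₂, hq₂, hS₂⟩ := h₂ T₁ _ (hT.trans hT₁) hS₁
    exact ⟨_, (hT₁.trans hT₂).trans (Set.subset_insert _ _), Set.mem_insert _ _,
      (hS₂.step (FormulaCost.add (FormulaCost.mem (m := 0) (hT₂ hq₁))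
        (FormulaCost.mem (m := 0) hq₂) (by omega))).mono (by omega)⟩
  | mul _ _ h h₁ h₂ =>
    intro T m hT h'
    obtain ⟨T₁, hT₁, hq₁, hS₁⟩ := h₁ T m hT h'
    obtain ⟨T₂, hT₂, hq₂, hS₂⟩ := h₂ T₁ _ (hT.trans hT₁) hS₁
    exact ⟨_, (hT₁.trans hT₂).trans (Set.subset_insert _ _), Set.mem_insert _ _,
      (hS₂.step (FormulaCost.mul (FormulaCost.mem (m := 0) (hT₂ hq₁))
        (FormulaCost.mem (m := 0) hq₂) (by omega))).mono (by omega)⟩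

theorem extend_family {ι : Type*} (h : StraightLine m S) (s : Finset ι)
    (z : ι → MvPolynomial (Fin n) F) (hz : ∀ i ∈ s, FormulaCost S a (z i)) :
    ∃ S', S ⊆ S' ∧ (∀ i ∈ s, z i ∈ S') ∧ StraightLine (m + s.card * a) S' := by
  classical
  induction s using Finset.induction_on with
  | empty => exact ⟨S, subset_rfl, by simp, by simpa using h⟩
  | insert i s hi ih =>
    obtain ⟨T, hT, hmem, hst⟩ := ih fun j hj => hz j (by simp [hj])
    obtain ⟨T', hT', hmem', hst'⟩ := hst.extend ((hz i (by simp)).mono hT)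
    refine ⟨T', hT.trans hT', fun j hj => ?_, hst'.mono ?_⟩
    · rcases Finset.mem_insert.1 hj with rfl | hj
      · exact hmem'
      · exact hT' (hmem j hj)
    · rw [Finset.card_insert_of_notMem hi]; exact le_of_eq (by ring)

/-- All earlier levels stay available as results, so a recursion of depth `L` costs `L` times one
level instead of growing exponentially. -/
theorem extend_levels {ι : Type*} (h : StraightLine m S) (s : Finset ι)
    (z : ℕ → ι → MvPolynomial (Fin n) F) (L : ℕ)
    (hz : ∀ k < L, ∀ T, S ⊆ T → (∀ k' < k, ∀ i ∈ s, z k' i ∈ T) →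
      ∀ i ∈ s, FormulaCost T a (z k i)) :
    ∃ S', S ⊆ S' ∧ (∀ k < L, ∀ i ∈ s, z k i ∈ S') ∧
      StraightLine (m + L * (s.card * a)) S' := by
  induction L with
  | zero => exact ⟨S, subset_rfl, by simp, by simpa using h⟩
  | succ L ih =>
    obtain ⟨T, hT, hmem, hst⟩ := ih fun k hk => hz k (by omega)
    obtain ⟨T', hT', hmem', hst'⟩ := hst.extend_family s (z L) (hz L (by omega) T hT hmem)
    refine ⟨T', hT.trans hT', fun k hk i hi => ?_, hst'.mono (le_of_eq (by ring))⟩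
    rcases Nat.lt_succ_iff_lt_or_eq.1 hk with hk | rfl
    · exact hT' (hmem k hk i hi)
    · exact hmem' i hi

theorem union (h : StraightLine m S) (h' : StraightLine m' T) : StraightLine (m + m') (S ∪ T) := by
  induction h' with
  | nil => rw [Set.union_empty]; exact h.mono (by omega)
  | step _ hq ih =>
    rw [Set.union_insert]
    exact step ih (hq.mono Set.subset_union_right)

/-- If a finite family of functions of a polynomial at a sum and at a product is computed from the
families at the operands, then the families at all results of a straight-line program are computed
by a straight-line program. -/
theorem transfer {F' : Type*} [CommSemiring F'] {ι : Type*} (s : Finset ι)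
    (z : ι → MvPolynomial (Fin n) F → MvPolynomial (Fin n) F') (a : ℕ)
    (hC : ∀ c, ∀ i ∈ s, FormulaCost ∅ a (z i (C c)))
    (hX : ∀ j, ∀ i ∈ s, FormulaCost ∅ a (z i (X j)))
    (hadd : ∀ P Q T, (∀ i ∈ s, z i P ∈ T ∧ z i Q ∈ T) → ∀ i ∈ s, FormulaCost T a (z i (P + Q)))
    (hmul : ∀ P Q T, (∀ i ∈ s, z i P ∈ T ∧ z i Q ∈ T) → ∀ i ∈ s, FormulaCost T a (z i (P * Q)))
    (h : StraightLine m S) :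
    ∃ S', StraightLine (m * (s.card * a)) S' ∧ ∀ P ∈ S, ∀ i ∈ s, z i P ∈ S' := by
  induction h with
  | nil => exact ⟨∅, nil, by simp⟩
  | @step m S q hS hq ih =>
    obtain ⟨T, hT, hmem⟩ := ih
    have hcost : ∀ i ∈ s, FormulaCost T a (z i q) := by
      cases hq with
      | mem h => exact fun i hi => FormulaCost.mem (hmem _ h i hi)
      | const c => exact fun i hi => (hC c i hi).mono (Set.empty_subset _)
      | var j => exact fun i hi => (hX j i hi).mono (Set.empty_subset _)
      | @add b c _ _ _ h₁ h₂ h =>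
        obtain ⟨rfl, rfl⟩ : b = 0 ∧ c = 0 := by omega
        exact hadd _ _ _ fun i hi =>
          ⟨hmem _ h₁.mem_of_zero i hi, hmem _ h₂.mem_of_zero i hi⟩
      | @mul b c _ _ _ h₁ h₂ h =>
        obtain ⟨rfl, rfl⟩ : b = 0 ∧ c = 0 := by omega
        exact hmul _ _ _ fun i hi =>
          ⟨hmem _ h₁.mem_of_zero i hi, hmem _ h₂.mem_of_zero i hi⟩
    obtain ⟨T', hTT', hmem', hT'⟩ := hT.extend_family s (fun i => z i q) hcost
    refine ⟨T', hT'.mono (le_of_eq (by ring)), fun P hP i hi => ?_⟩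
    rcases hP with rfl | hP
    · exact hmem' i hi
    · exact hTT' (hmem P hP i hi)

/-- A straight-line program is a circuit of fan-in two. -/
theorem exists_circuit (h : StraightLine m S) :
    ∃ (k : ℕ) (c : AlgCircuit n F k), c.size ≤ 3 * m ∧ ∀ q ∈ S, c.Computes q := by
  induction h with
  | nil => exact ⟨0, .nil, Nat.zero_le _, by simp⟩
  | @step m S q _ hq ih =>
    obtain ⟨k, c, hc, hS⟩ := ih
    have key : ∀ g : CircuitGate n F k, g.fanIn ≤ 2 → g.value c.value = q →
        ∃ (k : ℕ) (c : AlgCircuit n F k), c.size ≤ 3 * (m + 1) ∧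
          ∀ q' ∈ insert q S, c.Computes q' := by
      intro g hg hgq
      refine ⟨k + 1, c.snoc g, by simp only [AlgCircuit.size]; omega, fun q' hq' => ?_⟩
      rcases hq' with rfl | hq'
      · exact ⟨Fin.last k, by simp only [AlgCircuit.value, Fin.snoc_last, hgq]⟩
      · obtain ⟨o, ho⟩ := hS q' hq'
        exact ⟨o.castSucc, by simp only [AlgCircuit.value, Fin.snoc_castSucc, ho]⟩
    cases hq with
    | mem h => exact ⟨k, c, by omega, fun q' hq' => hS q' (by
        rcases hq' with rfl | hq'
        exacts [h, hq'])⟩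
    | const x => exact key (.const x) (by simp [CircuitGate.fanIn]) rfl
    | var i => exact key (.var i) (by simp [CircuitGate.fanIn]) rfl
    | @add b d _ _ _ h₁ h₂ h =>
      obtain ⟨rfl, rfl⟩ : b = 0 ∧ d = 0 := by omega
      obtain ⟨o₁, ho₁⟩ := hS _ h₁.mem_of_zero
      obtain ⟨o₂, ho₂⟩ := hS _ h₂.mem_of_zero
      exact key (.add [o₁, o₂]) (by simp [CircuitGate.fanIn])
        (by simp [CircuitGate.value, ho₁, ho₂])
    | @mul b d _ _ _ h₁ h₂ h =>
      obtain ⟨rfl, rfl⟩ : b = 0 ∧ d = 0 := by omega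
      obtain ⟨o₁, ho₁⟩ := hS _ h₁.mem_of_zero
      obtain ⟨o₂, ho₂⟩ := hS _ h₂.mem_of_zero
      exact key (.mul [o₁, o₂]) (by simp [CircuitGate.fanIn])
        (by simp [CircuitGate.value, ho₁, ho₂])

theorem circuitSize_le (h : StraightLine m S) (hq : q ∈ S) : circuitSize q ≤ (3 * m : ℕ) := by
  obtain ⟨k, c, hc, hS⟩ := h.exists_circuit
  exact (circuitSize_le_iff q _).2 ⟨k, c, hS q hq, hc⟩

end StraightLine

/-- The gates of a circuit are computed by a straight-line program. -/
theorem AlgCircuit.exists_straightLine {k : ℕ} (c : AlgCircuit n F k) :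
    ∃ S, StraightLine c.size S ∧ ∀ o, c.value o ∈ S := by
  induction c with
  | nil => exact ⟨∅, .nil, fun o => o.elim0⟩
  | @snoc k c g ih =>
    obtain ⟨S, hS, hmem⟩ := ih
    have hg : FormulaCost S (1 + g.fanIn) (g.value c.value) := by
      cases g with
      | var i => exact FormulaCost.var i
      | const x => exact FormulaCost.const x
      | add l =>
        simpa [CircuitGate.fanIn, CircuitGate.value] using
          FormulaCost.listSum (S := S) (l.map c.value) (by simpa using fun o _ => hmem o)
      | mul l =>
        simpa [CircuitGate.fanIn, CircuitGate.value] using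
          FormulaCost.listProd (S := S) (l.map c.value) (by simpa using fun o _ => hmem o)
    obtain ⟨S', hSS', hq, hS'⟩ := hS.extend hg
    refine ⟨S', hS', fun o => ?_⟩
    induction o using Fin.lastCases with
    | last => simpa only [AlgCircuit.value, Fin.snoc_last] using hq
    | cast o => simpa only [AlgCircuit.value, Fin.snoc_castSucc] using hSS' (hmem o)

theorem exists_straightLine_of_circuitSize_le {s : ℕ} (h : circuitSize q ≤ s) :
    ∃ S, StraightLine s S ∧ q ∈ S := by
  obtain ⟨k, c, ⟨o, ho⟩, hc⟩ := (circuitSize_le_iff q s).1 h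
  obtain ⟨S, hS, hmem⟩ := c.exists_straightLine
  exact ⟨S, hS.mono hc, ho ▸ hmem o⟩

end StraightLine

/-! ### Expansion along a line and linear recursions -/

section Expansion

open MvPolynomial

theorem FormulaCost.neg {n : ℕ} {K : Type*} [CommRing K] {S : Set (MvPolynomial (Fin n) K)}
    {q : MvPolynomial (Fin n) K} {a : ℕ} (h : FormulaCost S a q) : FormulaCost S (a + 2) (-q) := by
  have h1 : -q = C (-1) * q := by simp
  rw [h1]
  exact mul (const (m := 0) _) h (by omega)

/-- The coefficient of a sum of products of polynomials. -/
theorem FormulaCost.coeff_sum_mul {n : ℕ} {K : Type*} [CommSemiring K]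
    {S : Set (MvPolynomial (Fin n) K)} {ι : Type*} (s : Finset ι)
    (f g : ι → Polynomial (MvPolynomial (Fin n) K)) (l : ℕ)
    (h : ∀ x ∈ s, ∀ i ≤ l, (f x).coeff i ∈ S ∧ (g x).coeff i ∈ S) :
    FormulaCost S (s.card * ((l + 1) * 2 + 2) + 1) ((∑ x ∈ s, f x * g x).coeff l) := by
  rw [Polynomial.finsetSum_coeff]
  refine sum _ _ fun x hx => ?_
  rw [Polynomial.coeff_mul]
  have h1 := sum (S := S) (a := 1) (Finset.HasAntidiagonal.antidiagonal l)
    (fun y => (f x).coeff y.1 * (g x).coeff y.2) fun y hy => by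
      have hy' := Finset.HasAntidiagonal.mem_antidiagonal.1 hy
      exact mul (mem (m := 0) (h _ hx _ (by omega)).1)
        (mem (m := 0) (h _ hx _ (by omega)).2) (by omega)
  rw [Finset.Nat.card_antidiagonal] at h1
  exact h1

/-- A coefficient of a product involves only coefficients of no larger index in either variable, so
computing with truncated expansions is exact. -/
theorem FormulaCost.coeff_coeff_mul {n : ℕ} {K : Type*} [CommSemiring K]
    {S : Set (MvPolynomial (Fin n) K)} {w w' : Polynomial (Polynomial (MvPolynomial (Fin n) K))}
    {i k : ℕ} (h : ∀ i' ≤ i, ∀ k' ≤ k, (w.coeff k').coeff i' ∈ S ∧ (w'.coeff k').coeff i' ∈ S) :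
    FormulaCost S ((k + 1) * ((i + 1) * 2 + 2) + 1) (((w * w').coeff k).coeff i) := by
  rw [Polynomial.coeff_mul, ← Finset.Nat.card_antidiagonal k]
  refine coeff_sum_mul _ _ _ _ fun x hx i' hi' => ?_
  have hx' := Finset.HasAntidiagonal.mem_antidiagonal.1 hx
  exact ⟨(h _ hi' _ (by omega)).1, (h _ hi' _ (by omega)).2⟩

section Line

variable {σ F K : Type*} [CommSemiring F] [CommRing K] (φ : F →+* K) (a b : σ → K)

/-- The expansion of a polynomial at `a + y b + τ (x - a)`, as a polynomial in `τ` over the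
polynomials in `y` over `K[x]`. -/
noncomputable def lineExpansion :
    MvPolynomial σ F →+* Polynomial (Polynomial (MvPolynomial σ K)) :=
  restrictLine ((Polynomial.C.comp C).comp φ)
    (fun i => Polynomial.C (C (a i)) + Polynomial.C (C (b i)) * Polynomial.X)
    (fun i => Polynomial.C (X i - C (a i)))

theorem lineExpansion_C (c : F) :
    lineExpansion φ a b (C c) = Polynomial.C (Polynomial.C (C (φ c))) := by
  simp [lineExpansion, restrictLine]

theorem lineExpansion_X (i : σ) : lineExpansion φ a b (X i) =
    Polynomial.C (Polynomial.C (C (a i)) + Polynomial.C (C (b i)) * Polynomial.X) +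
      Polynomial.C (Polynomial.C (X i - C (a i))) * Polynomial.X := by
  simp [lineExpansion, restrictLine]

theorem coeff_zero_lineExpansion (P : MvPolynomial σ F) :
    (lineExpansion φ a b P).coeff 0 = (restrictLine φ a b P).map C := by
  rw [Polynomial.coeff_zero_eq_eval_zero, lineExpansion, eval_zero_restrictLine, map_restrictLine]
  rfl

/-- Each variable expands to joint degree at most one in `y` and `τ`. For `k ≥ 1` this makes the
`y`-degree of the coefficient of `τ ^ k` strictly smaller than the degree of `P`, which gives
uniqueness in the linear systems below. -/
theorem coeff_coeff_lineExpansion_eq_zero (P : MvPolynomial σ F) {i k : ℕ}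
    (h : P.totalDegree < i + k) : ((lineExpansion φ a b P).coeff k).coeff i = 0 := by
  classical
  let Bd : ℕ → Polynomial (Polynomial (MvPolynomial σ K)) → Prop := fun n w =>
    ∀ i k, n < i + k → (w.coeff k).coeff i = 0
  have hC : ∀ c, Bd 0 (Polynomial.C (Polynomial.C c)) := by
    intro c i k hik
    rw [Polynomial.coeff_C]
    split_ifs with hk
    · rw [Polynomial.coeff_C, if_neg (by omega)]
    · exact Polynomial.coeff_zero _
  have hmul : ∀ n n' w w', Bd n w → Bd n' w' → Bd (n + n') (w * w') := by
    intro n n' w w' hw hw' i k hik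
    rw [Polynomial.coeff_mul, Polynomial.finsetSum_coeff]
    refine Finset.sum_eq_zero fun x hx => ?_
    rw [Polynomial.coeff_mul]
    refine Finset.sum_eq_zero fun y hy => ?_
    have hx' := Finset.HasAntidiagonal.mem_antidiagonal.1 hx
    have hy' := Finset.HasAntidiagonal.mem_antidiagonal.1 hy
    by_cases h1 : n < y.1 + x.1
    · rw [hw _ _ h1, zero_mul]
    · rw [hw' _ _ (by omega), mul_zero]
  have hX : ∀ j, Bd 1 (lineExpansion φ a b (X j)) := by
    intro j i k hik
    rw [lineExpansion_X]
    rcases k with _ | _ | k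
    · simp [Polynomial.coeff_C, Polynomial.coeff_X, show i ≠ 0 by omega, show ¬ 1 = i by omega]
    · simp [Polynomial.coeff_C, show i ≠ 0 by omega]
    · simp
  have hpow : ∀ j e, Bd e (lineExpansion φ a b (X j) ^ e) := by
    intro j e
    induction e with
    | zero => rw [pow_zero]; exact hC 1
    | succ e ih => rw [pow_succ]; exact hmul _ _ _ _ ih (hX j)
  have hprod : ∀ (α : σ →₀ ℕ) (s : Finset σ),
      Bd (∑ j ∈ s, α j) (∏ j ∈ s, lineExpansion φ a b (X j) ^ α j) := by
    intro α s
    induction s using Finset.induction_on with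
    | empty => exact hC 1
    | insert j s hj ih =>
      rw [Finset.prod_insert hj, Finset.sum_insert hj]
      exact hmul _ _ _ _ (hpow j _) ih
  have hmon : ∀ (α : σ →₀ ℕ) (c : F), Bd α.degree (lineExpansion φ a b (monomial α c)) := by
    intro α c
    rw [monomial_eq, map_mul, lineExpansion_C, Finsupp.prod, map_prod]
    simp only [map_pow]
    have h1 := hmul 0 _ _ _ (hC (C (φ c))) (hprod α α.support)
    rwa [zero_add] at h1
  rw [P.as_sum, map_sum, Polynomial.finsetSum_coeff, Polynomial.finsetSum_coeff]
  exact Finset.sum_eq_zero fun α hα => hmon α _ i k ((le_totalDegree hα).trans_lt h)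

/-- At `y = 0`, `τ = 1` the expansion point `a + y b + τ (x - a)` is `x`. -/
theorem sum_coeff_zero_lineExpansion (P : MvPolynomial σ F) {N : ℕ} (hN : P.totalDegree < N) :
    ∑ k ∈ Finset.range N, ((lineExpansion φ a b P).coeff k).coeff 0 = map φ P := by
  have hdeg : (lineExpansion φ a b P).natDegree < N :=
    (restrictLine_natDegree_le_and_coeff _ _ _ P).1.trans_lt hN
  have h1 : Polynomial.eval 0 (Polynomial.eval 1 (lineExpansion φ a b P)) = map φ P := by
    change ((Polynomial.evalRingHom 0).comp ((Polynomial.evalRingHom 1).comp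
      (lineExpansion φ a b))) P = map φ P
    refine congrArg (fun f : MvPolynomial σ F →+* MvPolynomial σ K => f P) (ringHom_ext ?_ ?_)
    · intro c; simp [lineExpansion_C]
    · intro i; simp [lineExpansion_X]
  rw [← h1, Polynomial.eval_eq_sum_range' hdeg]
  simp [Polynomial.eval_finsetSum, Polynomial.coeff_zero_eq_eval_zero]

end Line

section Solve

variable {σ K : Type*} [Field K]

/-- If `(u, v) ↦ P u + Q v mod y ^ M` is injective on polynomials of bounded degree over a field
`K`, then it has a left inverse given by constants of `K`, also on polynomials over `K[σ]`. -/
theorem exists_coeff_eq_sum (P Q : Polynomial K) (m₁ m₂ M : ℕ)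
    (hinj : ∀ u v : Polynomial K, u.degree < m₁ → v.degree < m₂ →
      (∀ l < M, (P * u + Q * v).coeff l = 0) → u = 0 ∧ v = 0) :
    ∃ c₁ c₂ : ℕ → Fin M → K, ∀ u v : Polynomial (MvPolynomial σ K), u.degree < m₁ →
      v.degree < m₂ → ∀ i,
        u.coeff i = ∑ l : Fin M, C (c₁ i l) * (P.map C * u + Q.map C * v).coeff l ∧
        v.coeff i = ∑ l : Fin M, C (c₂ i l) * (P.map C * u + Q.map C * v).coeff l := by
  classical
  let Λ : (Polynomial.degreeLT K m₁ × Polynomial.degreeLT K m₂) →ₗ[K] (Fin M → K) :=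
    { toFun := fun z l => (P * z.1 + Q * z.2).coeff l
      map_add' := fun z z' => by ext l; simp [mul_add]; ring
      map_smul' := fun c z => by ext l; simp [mul_add] }
  have hker : LinearMap.ker Λ = ⊥ := by
    rw [LinearMap.ker_eq_bot']
    rintro ⟨⟨u, hu⟩, ⟨v, hv⟩⟩ h
    obtain ⟨rfl, rfl⟩ := hinj u v (Polynomial.mem_degreeLT.1 hu) (Polynomial.mem_degreeLT.1 hv)
      fun l hl => congrFun h ⟨l, hl⟩
    rfl
  -- The matrix entries of `Γ` are the constants `c₁` and `c₂`.
  obtain ⟨Γ, hΓ⟩ := Λ.exists_leftInverse_of_injective hker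
  have hK : ∀ z, ∀ i, (z.1 : Polynomial K).coeff i =
      ∑ l : Fin M, ((Γ (Pi.single l 1)).1 : Polynomial K).coeff i * Λ z l ∧
      (z.2 : Polynomial K).coeff i =
        ∑ l : Fin M, ((Γ (Pi.single l 1)).2 : Polynomial K).coeff i * Λ z l := by
    intro z i
    have h1 : Γ (Λ z) = z := LinearMap.congr_fun hΓ z
    have h2 : Λ z = ∑ l, Λ z l • Pi.single l (1 : K) := by
      ext j
      simp [Finset.sum_apply, Pi.single_apply]
    rw [h2, map_sum] at h1
    simp only [map_smul] at h1
    have h3 := congrArg (fun z => (z.1 : Polynomial K).coeff i) h1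
    have h4 := congrArg (fun z => (z.2 : Polynomial K).coeff i) h1
    simp only [Prod.fst_sum, Prod.snd_sum, Prod.smul_fst, Prod.smul_snd, Submodule.coe_sum,
      Submodule.coe_smul, Polynomial.finsetSum_coeff, Polynomial.coeff_smul, smul_eq_mul] at h3 h4
    rw [← h3, ← h4]
    exact ⟨Finset.sum_congr rfl fun l _ => mul_comm _ _,
      Finset.sum_congr rfl fun l _ => mul_comm _ _⟩
  refine ⟨fun i l => ((Γ (Pi.single l 1)).1 : Polynomial K).coeff i,
    fun i l => ((Γ (Pi.single l 1)).2 : Polynomial K).coeff i, fun u v hu hv i => ?_⟩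
  -- The system has coefficients in `K`, so it splits into one system over `K` for each monomial `α`
  -- of `K[σ]`.
  have hproj : ∀ (m : ℕ) (u : Polynomial (MvPolynomial σ K)), u.degree < m → ∀ α,
      ∃ u' : Polynomial K, u'.degree < m ∧ ∀ i, u'.coeff i = coeff α (u.coeff i) := by
    intro m u hu α
    have hco : ∀ i, (∑ j ∈ Finset.range m, Polynomial.monomial j (coeff α (u.coeff j))).coeff i =
        coeff α (u.coeff i) := by
      intro i
      simp only [Polynomial.finsetSum_coeff, Polynomial.coeff_monomial, Finset.sum_ite_eq',
        Finset.mem_range]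
      split_ifs with him
      · rfl
      · rw [Polynomial.coeff_eq_zero_of_degree_lt (hu.trans_le (by exact_mod_cast not_lt.1 him)),
          coeff_zero]
    refine ⟨_, (Polynomial.degree_lt_iff_coeff_zero _ _).2 fun i hi => ?_, hco⟩
    rw [hco, Polynomial.coeff_eq_zero_of_degree_lt (hu.trans_le (by exact_mod_cast hi)), coeff_zero]
  have hmulco : ∀ (P u' : Polynomial K) (u : Polynomial (MvPolynomial σ K)) α,
      (∀ i, u'.coeff i = coeff α (u.coeff i)) →
        ∀ l, coeff α ((P.map C * u).coeff l) = (P * u').coeff l := by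
    intro P u' u α h l
    rw [Polynomial.coeff_mul, Polynomial.coeff_mul, coeff_sum]
    exact Finset.sum_congr rfl fun x _ => by rw [Polynomial.coeff_map, coeff_C_mul, h]
  have key : ∀ α, coeff α (u.coeff i) = coeff α (∑ l : Fin M,
        C (((Γ (Pi.single l 1)).1 : Polynomial K).coeff i) * (P.map C * u + Q.map C * v).coeff l) ∧
      coeff α (v.coeff i) = coeff α (∑ l : Fin M,
        C (((Γ (Pi.single l 1)).2 : Polynomial K).coeff i) *
          (P.map C * u + Q.map C * v).coeff l) := by
    intro α
    obtain ⟨u', hu', hu'co⟩ := hproj m₁ u hu α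
    obtain ⟨v', hv', hv'co⟩ := hproj m₂ v hv α
    have h1 := hK (⟨u', Polynomial.mem_degreeLT.2 hu'⟩, ⟨v', Polynomial.mem_degreeLT.2 hv'⟩) i
    have h2 : ∀ l : Fin M, coeff α ((P.map C * u + Q.map C * v).coeff l) =
        (P * u' + Q * v').coeff l := fun l => by
      rw [Polynomial.coeff_add, coeff_add, Polynomial.coeff_add, hmulco P u' u α hu'co,
        hmulco Q v' v α hv'co]
    simp only [coeff_sum, coeff_C_mul, h2, ← hu'co, ← hv'co]
    exact h1
  exact ⟨MvPolynomial.ext _ _ fun α => (key α).1, MvPolynomial.ext _ _ fun α => (key α).2⟩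

/-- A pair `U, V` of polynomials in `τ` and `y` with constant terms over `K` is computed coefficient
by coefficient in `τ` if the earlier coefficients determine `P U + Q V mod y ^ M`, where `P, Q` are
polynomials over `K` for which this determines the next coefficient. -/
theorem StraightLine.solve {n : ℕ} {S : Set (MvPolynomial (Fin n) K)} {m₀ : ℕ}
    (hS : StraightLine m₀ S) (P Q : Polynomial K) (m₁ m₂ M I L ω : ℕ)
    (hinj : ∀ u v : Polynomial K, u.degree < m₁ → v.degree < m₂ →
      (∀ l < M, (P * u + Q * v).coeff l = 0) → u = 0 ∧ v = 0)
    (U V : Polynomial (Polynomial (MvPolynomial (Fin n) K)))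
    (hU₀ : ∀ i, ∃ c, (U.coeff 0).coeff i = C c) (hV₀ : ∀ i, ∃ c, (V.coeff 0).coeff i = C c)
    (hU : ∀ k, 1 ≤ k → (U.coeff k).degree < m₁) (hV : ∀ k, 1 ≤ k → (V.coeff k).degree < m₂)
    (hw : ∀ k, 1 ≤ k → k < L → ∀ T, S ⊆ T →
      (∀ k' < k, ∀ i < I, (U.coeff k').coeff i ∈ T ∧ (V.coeff k').coeff i ∈ T) →
        ∀ l < M, FormulaCost T ω ((P.map C * U.coeff k + Q.map C * V.coeff k).coeff l)) :
    ∃ S', S ⊆ S' ∧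
      (∀ k < L, ∀ i < I, (U.coeff k).coeff i ∈ S' ∧ (V.coeff k).coeff i ∈ S') ∧
      StraightLine (m₀ + L * (2 * I * (M * (ω + 3) + 1))) S' := by
  obtain ⟨c₁, c₂, hc⟩ := exists_coeff_eq_sum (σ := Fin n) P Q m₁ m₂ M hinj
  obtain ⟨S', hSS', hmem, hS'⟩ := hS.extend_levels (a := M * (ω + 3) + 1)
    ((Finset.univ : Finset Bool) ×ˢ Finset.range I)
    (fun k x => if x.1 then (U.coeff k).coeff x.2 else (V.coeff k).coeff x.2) L (by
      intro k hk T hST hT x hx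
      have hxI : x.2 < I := by simpa using hx
      -- The level `τ ^ 0` consists of elements of `K`, hard-wired as constants; this also fixes the
      -- normalization of the pair.
      rcases Nat.eq_zero_or_pos k with rfl | hpos
      · obtain ⟨c, hc⟩ := hU₀ x.2
        obtain ⟨d, hd⟩ := hV₀ x.2
        split_ifs
        · rw [hc]; exact FormulaCost.const c
        · rw [hd]; exact FormulaCost.const d
      · have hw' := hw k hpos hk T hST fun k' hk' i hi =>
          ⟨by simpa using hT k' hk' (true, i) (by simpa using hi),
            by simpa using hT k' hk' (false, i) (by simpa using hi)⟩
        have hsum : ∀ c : Fin M → K, FormulaCost T (M * (ω + 3) + 1)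
            (∑ l : Fin M, C (c l) * (P.map C * U.coeff k + Q.map C * V.coeff k).coeff l) := by
          intro c
          have := FormulaCost.sum (S := T) (a := ω + 2) (Finset.univ : Finset (Fin M))
            (fun l => C (c l) * (P.map C * U.coeff k + Q.map C * V.coeff k).coeff l)
            fun l _ => FormulaCost.mul (FormulaCost.const (m := 0) _) (hw' l l.2) (by omega)
          rwa [Finset.card_univ, Fintype.card_fin] at this
        obtain ⟨h1, h2⟩ := hc _ _ (hU k hpos) (hV k hpos) x.2
        split_ifs
        · rw [h1]; exact hsum _
        · rw [h2]; exact hsum _)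
  refine ⟨S', hSS', fun k hk i hi => ⟨?_, ?_⟩, hS'.mono (le_of_eq ?_)⟩
  · simpa using hmem k hk (true, i) (by simpa using hi)
  · simpa using hmem k hk (false, i) (by simpa using hi)
  · simp

end Solve

end Expansion

/-! ### Circuits for the factors of the denominator of a fraction -/

section Factor

open MvPolynomial

namespace Polynomial

variable {K : Type*} [Field K]

theorem degree_mul_lt_of_natDegree_le {P u : Polynomial K} {m m' : ℕ} (hP : P.natDegree ≤ m)
    (hu : u.degree < m') : (P * u).degree < (m + m' : ℕ) := by
  by_cases h0 : u = 0
  · rw [h0, mul_zero, degree_zero]; exact WithBot.bot_lt_coe _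
  refine degree_le_natDegree.trans_lt ?_
  have h1 := (natDegree_lt_iff_degree_lt h0).2 hu
  have h2 := natDegree_mul_le_of_le hP (le_refl u.natDegree)
  exact_mod_cast (by omega : (P * u).natDegree < m + m')

/-- Coprimality makes `Q` divide `u`, which is too small in degree to be a nonzero multiple. -/
theorem eq_zero_of_mul_add_mul_eq_zero {P Q u v : Polynomial K} (h : IsCoprime Q P)
    (hu : u.degree < Q.degree) (huv : P * u + Q * v = 0) : u = 0 ∧ v = 0 := by
  have h1 : Q ∣ P * u := ⟨-v, by linear_combination huv⟩
  have h2 : u = 0 := eq_zero_of_dvd_of_degree_lt (h.dvd_of_dvd_mul_left h1) hu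
  subst h2
  refine ⟨rfl, ?_⟩
  rw [mul_zero, zero_add, mul_eq_zero] at huv
  exact huv.resolve_left fun h0 => by simp [h0] at hu

/-- `P * u + Q * v` has degree below `m₁ + m₂`, so vanishing modulo `X ^ M` is the same as
vanishing. This is the uniqueness behind Hensel lifting. -/
theorem eq_zero_of_coeff_mul_add_mul {P Q u v : Polynomial K} {m₁ m₂ M : ℕ} (h : IsCoprime Q P)
    (hQ : Q.degree = m₁) (hP : P.natDegree ≤ m₂) (hu : u.degree < m₁) (hv : v.degree < m₂)
    (hM : m₁ + m₂ ≤ M) (huv : ∀ l < M, (P * u + Q * v).coeff l = 0) : u = 0 ∧ v = 0 := by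
  refine eq_zero_of_mul_add_mul_eq_zero h (hQ ▸ hu) ?_
  have h1 := degree_mul_lt_of_natDegree_le hP hu
  have h2 := degree_mul_lt_of_natDegree_le (natDegree_le_of_degree_le hQ.le) hv
  rw [add_comm m₂] at h1
  have h3 := (degree_add_le _ _).trans_lt (max_lt h1 h2)
  ext l
  rw [coeff_zero]
  by_cases hl : l < M
  · exact huv l hl
  · exact coeff_eq_zero_of_degree_lt (h3.trans_le (by exact_mod_cast hM.trans (not_lt.1 hl)))

/-- Multiplication by `R` turns `A * u - B * v` into `B * (N * u - R * v)`, and `B` cancels because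
it is invertible modulo `X ^ M`. This is the uniqueness of Padé approximants; the degrees of `A` and
`B` do not matter. -/
theorem eq_zero_of_coeff_mul_sub_mul {A B R N u v : Polynomial K} {m M : ℕ} (h : IsCoprime R N)
    (hAB : A * R = B * N) (hB : B.eval 0 ≠ 0) (hR : R.degree = m) (hN : N.natDegree ≤ m)
    (hu : u.degree < m) (hv : v.degree < m) (hM : m + m ≤ M)
    (huv : ∀ l < M, (A * u + -B * v).coeff l = 0) : u = 0 ∧ v = 0 := by
  have h1 : X ^ M ∣ A * u + -B * v := X_pow_dvd_iff.2 huv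
  have h2 : X ^ M ∣ B * (N * u + R * -v) := by
    refine (h1.mul_right R).trans (dvd_of_eq ?_)
    linear_combination u * hAB
  have hcop : IsCoprime (X ^ M) B := by
    refine IsCoprime.pow_left ((irreducible_X (R := K)).coprime_iff_not_dvd.2 fun hd => hB ?_)
    rwa [X_dvd_iff, coeff_zero_eq_eval_zero] at hd
  have h3 := X_pow_dvd_iff.1 (hcop.dvd_of_dvd_mul_left h2)
  obtain ⟨h4, h5⟩ := eq_zero_of_coeff_mul_add_mul h hR hN hu (by rwa [degree_neg]) hM h3
  exact ⟨h4, neg_eq_zero.1 h5⟩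

end Polynomial

variable {n : ℕ} {F K : Type*} [Field F] [Field K] (φ : F →+* K) (a b : Fin n → K)

/-- The coefficients of the expansions of the gates of a straight-line program and of their images
under a derivation are computed by a straight-line program. -/
theorem StraightLine.exists_coeff_lineExpansion {S : Set (MvPolynomial (Fin n) F)} {s M L μ : ℕ}
    (hS : StraightLine s S) (D : MvPolynomial (Fin n) F →+ MvPolynomial (Fin n) F)
    (hDmul : ∀ P Q, D (P * Q) = P * D Q + Q * D P) (hDC : ∀ c, ∃ c', D (C c) = C c')
    (hDX : ∀ i, ∃ c', D (X i) = C c') (hμ : L * (M * 2 + 2) + 1 ≤ μ) :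
    ∃ T, StraightLine (s * (2 * (M * L) * (2 * μ + 1))) T ∧ ∀ P ∈ S, ∀ i < M, ∀ k < L,
      ((lineExpansion φ a b P).coeff k).coeff i ∈ T ∧
        ((lineExpansion φ a b (D P)).coeff k).coeff i ∈ T := by
  let z : Bool × ℕ × ℕ → MvPolynomial (Fin n) F → MvPolynomial (Fin n) K := fun x P =>
    ((lineExpansion φ a b (if x.1 then D P else P)).coeff x.2.2).coeff x.2.1
  have hconst : ∀ (c : F) i k, FormulaCost ∅ (2 * μ + 1)
      (((lineExpansion φ a b (C c)).coeff k).coeff i) := by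
    intro c i k
    rw [lineExpansion_C, Polynomial.coeff_C]
    split_ifs
    · rw [Polynomial.coeff_C]
      split_ifs
      · exact FormulaCost.const _
      · rw [← C_0]; exact FormulaCost.const _
    · rw [Polynomial.coeff_zero, ← C_0]; exact FormulaCost.const _
  have hmul : ∀ (P Q : MvPolynomial (Fin n) F) T i k, i < M → k < L →
      (∀ i < M, ∀ k < L, ((lineExpansion φ a b P).coeff k).coeff i ∈ T ∧
        ((lineExpansion φ a b Q).coeff k).coeff i ∈ T) →
      FormulaCost T μ (((lineExpansion φ a b (P * Q)).coeff k).coeff i) := by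
    intro P Q T i k hi hk h
    rw [map_mul]
    refine (FormulaCost.coeff_coeff_mul fun i' hi' k' hk' =>
      h i' (by omega) k' (by omega)).mono_cost (le_trans ?_ hμ)
    gcongr <;> omega
  obtain ⟨T, hT, hmem⟩ := hS.transfer
    ((Finset.univ : Finset Bool) ×ˢ (Finset.range M ×ˢ Finset.range L)) z (2 * μ + 1)
    (by
      rintro c ⟨e, i, k⟩ -
      cases e
      · exact hconst c i k
      · obtain ⟨c', hc'⟩ := hDC c
        simp only [z, if_true, hc']
        exact hconst c' i k)
    (by
      rintro j ⟨e, i, k⟩ -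
      cases e
      · change FormulaCost ∅ (2 * μ + 1) (((lineExpansion φ a b (X j)).coeff k).coeff i)
        rw [lineExpansion_X]
        rcases k with _ | _ | k
        · rcases i with _ | _ | i
          · simpa using FormulaCost.const (m := 2 * μ) (S := ∅) (a j)
          · simpa using FormulaCost.const (m := 2 * μ) (S := ∅) (b j)
          · simpa [Polynomial.coeff_C, Polynomial.coeff_X] using
              FormulaCost.const (m := 2 * μ) (S := ∅) (n := n) (0 : K)
        · rcases i with _ | i
          · have h1 : FormulaCost ∅ (2 * μ + 1) (X j + C (-a j)) :=
              FormulaCost.add (FormulaCost.var (m := 0) j) (FormulaCost.const (m := 0) _)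
                (by omega)
            simpa [Polynomial.coeff_C, sub_eq_add_neg] using h1
          · simpa [Polynomial.coeff_C] using
              FormulaCost.const (m := 2 * μ) (S := ∅) (n := n) (0 : K)
        · simpa using FormulaCost.const (m := 2 * μ) (S := ∅) (n := n) (0 : K)
      · obtain ⟨c', hc'⟩ := hDX j
        simp only [z, if_true, hc']
        exact hconst c' i k)
    (by
      rintro P Q T h ⟨e, i, k⟩ hx
      obtain ⟨h1, h2⟩ := h _ hx
      have h3 : z (e, i, k) (P + Q) = z (e, i, k) P + z (e, i, k) Q := by
        cases e <;> simp [z]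
      rw [h3]
      exact FormulaCost.add (FormulaCost.mem (m := 0) h1) (FormulaCost.mem (m := 0) h2)
        (by omega))
    (by
      rintro P Q T h ⟨e, i, k⟩ hx
      have hx' : i < M ∧ k < L := by simpa using hx
      have hP : ∀ i < M, ∀ k < L, ((lineExpansion φ a b P).coeff k).coeff i ∈ T ∧
          ((lineExpansion φ a b Q).coeff k).coeff i ∈ T := fun i hi k hk =>
        h (false, i, k) (by simp [hi, hk])
      have hD : ∀ i < M, ∀ k < L, ((lineExpansion φ a b (D P)).coeff k).coeff i ∈ T ∧
          ((lineExpansion φ a b (D Q)).coeff k).coeff i ∈ T := fun i hi k hk =>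
        h (true, i, k) (by simp [hi, hk])
      cases e
      · exact (hmul P Q T i k hx'.1 hx'.2 hP).mono_cost (by omega)
      -- The Leibniz rule needs two products and one addition, whence the cost `2 * μ + 1`. It is
      -- also why the images under `D` are carried along with the gates.
      · have h3 : z (true, i, k) (P * Q) =
            ((lineExpansion φ a b (P * D Q)).coeff k).coeff i +
              ((lineExpansion φ a b (Q * D P)).coeff k).coeff i := by
          simp only [z, if_true, hDmul, map_add, Polynomial.coeff_add]
        rw [h3]
        exact FormulaCost.add
          (hmul P (D Q) T i k hx'.1 hx'.2 fun i hi k hk => ⟨(hP i hi k hk).1, (hD i hi k hk).2⟩)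
          (hmul Q (D P) T i k hx'.1 hx'.2 fun i hi k hk => ⟨(hP i hi k hk).2, (hD i hi k hk).1⟩)
          (by omega))
  refine ⟨T, hT.mono (le_of_eq ?_), fun P hP i hi k hk => ⟨?_, ?_⟩⟩
  · simp
  · exact hmem P hP (false, i, k) (by simp [hi, hk])
  · exact hmem P hP (true, i, k) (by simp [hi, hk])

/-- The coefficients of the expansions of the denominator `R` and the numerator `N` of a reduced
fraction are computed from those of the polynomials `A`, `B` with `A * R = B * N`. -/
theorem StraightLine.exists_coeff_fraction {A B R N : MvPolynomial (Fin n) F} {M L μ m₀ : ℕ}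
    {S : Set (MvPolynomial (Fin n) K)} (hS : StraightLine m₀ S)
    (hμ : L * (M * 2 + 2) + 1 ≤ μ) (hAB : A * R = B * N) (hM : R.totalDegree + R.totalDegree ≤ M)
    (hN : N.totalDegree ≤ R.totalDegree)
    (hcop : IsCoprime (restrictLine φ a b R) (restrictLine φ a b N))
    (hB : eval₂ φ a B ≠ 0)
    (hR : eval₂ φ b (homogeneousComponent R.totalDegree R) ≠ 0)
    (hmem : ∀ i < M, ∀ k < L, ((lineExpansion φ a b A).coeff k).coeff i ∈ S ∧
      ((lineExpansion φ a b B).coeff k).coeff i ∈ S) :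
    ∃ S', S ⊆ S' ∧ (∀ k < L, ∀ i < M, ((lineExpansion φ a b R).coeff k).coeff i ∈ S') ∧
      StraightLine (m₀ + L * (2 * M * (M * (2 * μ + 6) + 1))) S' := by
  obtain ⟨hRdeg, hRco⟩ := restrictLine_natDegree_le_and_coeff φ a b R
  -- The leading form of `R` does not vanish at the direction `b`, so no degree is lost on the line.
  have hRdeg' : (restrictLine φ a b R).degree = R.totalDegree :=
    Polynomial.degree_eq_of_le_of_coeff_ne_zero (Polynomial.natDegree_le_iff_degree_le.1 hRdeg)
      (by rwa [hRco])
  have hNdeg := (restrictLine_natDegree_le_and_coeff φ a b N).1.trans hN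
  have hlow : ∀ P : MvPolynomial (Fin n) F, P.totalDegree ≤ R.totalDegree → ∀ k, 1 ≤ k →
      ((lineExpansion φ a b P).coeff k).degree < R.totalDegree := fun P hP k hk =>
    (Polynomial.degree_lt_iff_coeff_zero _ _).2 fun i hi =>
      coeff_coeff_lineExpansion_eq_zero φ a b P (by omega)
  have hzero : ∀ P : MvPolynomial (Fin n) F, ∀ i, ∃ c,
      ((lineExpansion φ a b P).coeff 0).coeff i = C c := fun P i =>
    ⟨_, by rw [coeff_zero_lineExpansion, Polynomial.coeff_map]⟩
  obtain ⟨S', hSS', h1, h2⟩ := hS.solve (restrictLine φ a b A) (-restrictLine φ a b B)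
    R.totalDegree R.totalDegree M M L (2 * μ + 3)
    (fun u v hu hv huv => Polynomial.eq_zero_of_coeff_mul_sub_mul hcop
      (by rw [← map_mul, hAB, map_mul]) (by rwa [eval_zero_restrictLine]) hRdeg' hNdeg hu hv hM huv)
    (lineExpansion φ a b R) (lineExpansion φ a b N) (hzero R) (hzero N) (hlow R le_rfl)
    (hlow N hN) (by
      intro k hk hkL T hST hT l hl
      have hsum : ∀ P Q : MvPolynomial (Fin n) F, (lineExpansion φ a b (P * Q)).coeff k =
          ∑ j ∈ Finset.range k, (lineExpansion φ a b Q).coeff j *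
            (lineExpansion φ a b P).coeff (k - j) +
          (restrictLine φ a b P).map C * (lineExpansion φ a b Q).coeff k := by
        intro P Q
        rw [mul_comm P, map_mul, Polynomial.coeff_mul,
          Finset.Nat.sum_antidiagonal_eq_sum_range_succ
            (fun i j => (lineExpansion φ a b Q).coeff i * (lineExpansion φ a b P).coeff j),
          Finset.sum_range_succ, Nat.sub_self, coeff_zero_lineExpansion, mul_comm (Polynomial.map _ _)]
      -- The coefficient of `τ ^ k` in `A * R = B * N`, with the terms that contain the unknown
      -- coefficients of `R` and `N` on the left.
      have hexp : (restrictLine φ a b A).map C * (lineExpansion φ a b R).coeff k +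
          (-restrictLine φ a b B).map C * (lineExpansion φ a b N).coeff k =
          -(∑ j ∈ Finset.range k, (lineExpansion φ a b R).coeff j *
            (lineExpansion φ a b A).coeff (k - j)) +
          ∑ j ∈ Finset.range k, (lineExpansion φ a b N).coeff j *
            (lineExpansion φ a b B).coeff (k - j) := by
        have h3 := hsum A R
        rw [hAB, hsum B N] at h3
        rw [Polynomial.map_neg]
        linear_combination -h3
      rw [hexp, Polynomial.coeff_add, Polynomial.coeff_neg]
      have hle : (Finset.range k).card * ((l + 1) * 2 + 2) + 1 ≤ μ := by
        refine le_trans ?_ hμ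
        rw [Finset.card_range]
        gcongr
        omega
      refine FormulaCost.add (FormulaCost.neg ((FormulaCost.coeff_sum_mul _ _ _ l ?_).mono_cost hle))
        ((FormulaCost.coeff_sum_mul _ _ _ l ?_).mono_cost hle) (by omega)
      · intro j hj i hi
        have hj' := Finset.mem_range.1 hj
        exact ⟨(hT j hj' i (by omega)).1, hST (hmem i (by omega) (k - j) (by omega)).1⟩
      · intro j hj i hi
        have hj' := Finset.mem_range.1 hj
        exact ⟨(hT j hj' i (by omega)).2, hST (hmem i (by omega) (k - j) (by omega)).2⟩)
  exact ⟨S', hSS', fun k hk i hi => (h1 k hk i hi).1, h2⟩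

/-- **Hensel lifting**: the coefficients of the expansion of a factor `G` of `G * H` are computed
from those of `G * H`. -/
theorem StraightLine.exists_coeff_factor {G H : MvPolynomial (Fin n) F} {M L μ m₀ : ℕ}
    {S : Set (MvPolynomial (Fin n) K)} (hS : StraightLine m₀ S)
    (hμ : L * (M * 2 + 2) + 1 ≤ μ) (hGH : G * H ≠ 0) (hM : (G * H).totalDegree ≤ M)
    (hcop : IsCoprime (restrictLine φ a b G) (restrictLine φ a b H))
    (hR : eval₂ φ b (homogeneousComponent (G * H).totalDegree (G * H)) ≠ 0)
    (hmem : ∀ k < L, ∀ i < M, ((lineExpansion φ a b (G * H)).coeff k).coeff i ∈ S) :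
    ∃ S', S ⊆ S' ∧ (∀ k < L, ∀ i < M, ((lineExpansion φ a b G).coeff k).coeff i ∈ S') ∧
      StraightLine (m₀ + L * (2 * M * (M * (2 * μ + 6) + 1))) S' := by
  have hdeg := totalDegree_mul_of_isDomain (left_ne_zero_of_mul hGH) (right_ne_zero_of_mul hGH)
  have hGdeg := (restrictLine_natDegree_le_and_coeff φ a b G).1
  have hHdeg := (restrictLine_natDegree_le_and_coeff φ a b H).1
  -- The product keeps its degree on the line and neither factor can gain any, so each factor keeps
  -- its own.
  have hGdeg' : (restrictLine φ a b G).degree = G.totalDegree := by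
    have h1 := (restrictLine_natDegree_le_and_coeff φ a b (G * H)).2
    have h2 : (G * H).totalDegree ≤ (restrictLine φ a b (G * H)).natDegree :=
      Polynomial.le_natDegree_of_ne_zero (by rwa [h1])
    have hne : restrictLine φ a b (G * H) ≠ 0 := fun h0 => by
      rw [h0, Polynomial.coeff_zero] at h1
      exact hR h1.symm
    rw [map_mul] at h2 hne
    rw [Polynomial.natDegree_mul (left_ne_zero_of_mul hne) (right_ne_zero_of_mul hne)] at h2
    rw [Polynomial.degree_eq_natDegree (left_ne_zero_of_mul hne)]
    exact_mod_cast (by omega : (restrictLine φ a b G).natDegree = G.totalDegree)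
  have hlow : ∀ P : MvPolynomial (Fin n) F, ∀ k, 1 ≤ k →
      ((lineExpansion φ a b P).coeff k).degree < P.totalDegree := fun P k hk =>
    (Polynomial.degree_lt_iff_coeff_zero _ _).2 fun i hi =>
      coeff_coeff_lineExpansion_eq_zero φ a b P (by omega)
  have hzero : ∀ P : MvPolynomial (Fin n) F, ∀ i, ∃ c,
      ((lineExpansion φ a b P).coeff 0).coeff i = C c := fun P i =>
    ⟨_, by rw [coeff_zero_lineExpansion, Polynomial.coeff_map]⟩
  obtain ⟨S', hSS', h1, h2⟩ := hS.solve (restrictLine φ a b H) (restrictLine φ a b G)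
    G.totalDegree H.totalDegree M M L (2 * μ + 3)
    (fun u v hu hv huv => Polynomial.eq_zero_of_coeff_mul_add_mul hcop hGdeg' hHdeg hu hv
      (hdeg ▸ hM) huv)
    (lineExpansion φ a b G) (lineExpansion φ a b H) (hzero G) (hzero H) (hlow G)
    (hlow H) (by
      intro k hk hkL T hST hT l hl
      obtain ⟨k, rfl⟩ := Nat.exists_eq_add_of_le' hk
      -- In the coefficient of `τ ^ (k + 1)` of `G * H` the two end terms contain the unknowns; the
      -- middle terms use only earlier levels.
      have hexp : (restrictLine φ a b H).map C * (lineExpansion φ a b G).coeff (k + 1) +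
          (restrictLine φ a b G).map C * (lineExpansion φ a b H).coeff (k + 1) =
          (lineExpansion φ a b (G * H)).coeff (k + 1) +
          -(∑ j ∈ Finset.range k, (lineExpansion φ a b G).coeff (j + 1) *
            (lineExpansion φ a b H).coeff (k - j)) := by
        rw [map_mul, Polynomial.coeff_mul, Finset.Nat.sum_antidiagonal_eq_sum_range_succ
            (fun i j => (lineExpansion φ a b G).coeff i * (lineExpansion φ a b H).coeff j),
          Finset.sum_range_succ, Finset.sum_range_succ', Nat.sub_self, Nat.sub_zero,
          coeff_zero_lineExpansion, coeff_zero_lineExpansion]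
        simp only [Nat.add_sub_add_right]
        ring
      rw [hexp, Polynomial.coeff_add, Polynomial.coeff_neg]
      have hle : (Finset.range k).card * ((l + 1) * 2 + 2) + 1 ≤ μ := by
        refine le_trans ?_ hμ
        rw [Finset.card_range]
        gcongr <;> omega
      refine FormulaCost.add (FormulaCost.mem (m := 0) (hST (hmem _ hkL l hl)))
        (FormulaCost.neg ((FormulaCost.coeff_sum_mul _ _ _ l ?_).mono_cost hle)) (by omega)
      intro j hj i hi
      have hj' := Finset.mem_range.1 hj
      exact ⟨(hT (j + 1) (by omega) i (by omega)).1, (hT (k - j) (by omega) i (by omega)).2⟩)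
  exact ⟨S', hSS', fun k hk i hi => (h1 k hk i hi).1, h2⟩

end Factor

/-! ### Factors of the partial radical -/

section Main

open MvPolynomial

/-- Expansion of `A` and `B`, recovery of the denominator `h * h'`, lifting of `h` and summation
over `τ` are chained here on a single line that is good for all of them. -/
theorem StraightLine.map_irreducible_factor {n : ℕ} {F K : Type*} [Field F] [Field K] [Infinite K]
    (φ : F →+* K) (p : ℕ) [Fact p.Prime] [CharP F p] {u₀ u₁ h : MvPolynomial (Fin n) F}
    {S : Set (MvPolynomial (Fin n) F)} {t : ℕ} (hu : u₀ * u₁ ≠ 0) (hS : StraightLine t S)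
    (hf : u₀ * u₁ ∈ S) (hu₀ : u₀ ∈ S) (ht : 1 ≤ t) (hdeg : (partialRadical p u₁).totalDegree ≤ t)
    (hh : Irreducible h) (hr : h ∣ partialRadical p u₁) :
    ∃ S', StraightLine (4000 * t ^ 5) S' ∧ map φ h ∈ S' := by
  obtain ⟨D, h', N, hDmul, hDC, hDX, hhh', hRN, hR0, hAB, hRdeg, hNdeg⟩ :=
    exists_reduced_fraction (u₀ := u₀) (right_ne_zero_of_mul hu) hh hr
  set A := D (u₀ * u₁) * u₀ - u₀ * u₁ * D u₀ with hA
  set B := u₀ * u₁ * u₀ with hBdef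
  have hB0 : B ≠ 0 := mul_ne_zero hu (left_ne_zero_of_mul hu)
  have hT0 : homogeneousComponent (h * h').totalDegree (h * h') ≠ 0 := by
    intro h0
    obtain ⟨α, hα, hαd⟩ := (h * h').support.exists_mem_eq_sup
      (Finset.nonempty_of_ne_empty (mt support_eq_empty.1 hR0)) fun α => α.sum fun _ e => e
    have h1 := congrArg (coeff α) h0
    rw [coeff_homogeneousComponent, if_pos (by rw [totalDegree, hαd]; rfl), coeff_zero] at h1
    exact mem_support_iff.1 hα h1
  obtain ⟨a, b, hcop₁, hcop₂, hBa, hTb⟩ := exists_line φ hRN hhh' hB0 hT0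
  have hmt : (h * h').totalDegree ≤ t := hRdeg.trans hdeg
  have hhdeg : h.totalDegree ≤ (h * h').totalDegree :=
    totalDegree_le_of_dvd_of_isDomain (dvd_mul_right _ _) hR0
  generalize hm : (h * h').totalDegree = m at hmt
  -- Padé uniqueness needs precision `2 * m` in `y`, and the extra one makes the coefficient at `y ^
  -- 0` available for every `m`. `L = m + 1` exceeds the `τ`-degree of `h`, and `μ` bounds the cost
  -- of one truncated product.
  obtain ⟨M, hM⟩ : ∃ M, M = 2 * m + 1 := ⟨_, rfl⟩
  obtain ⟨L, hL⟩ : ∃ L, L = m + 1 := ⟨_, rfl⟩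
  obtain ⟨μ, hμ⟩ : ∃ μ, μ = L * (M * 2 + 2) + 1 := ⟨_, rfl⟩
  obtain ⟨T₁, hT₁, hmem₁⟩ := hS.exists_coeff_lineExpansion φ a b D hDmul hDC hDX hμ.ge
  obtain ⟨T₂, -, hmem₂, hT₂⟩ := hT₁.extend_family (a := 2 * μ + 3)
    ((Finset.univ : Finset Bool) ×ˢ (Finset.range M ×ˢ Finset.range L))
    (fun x => ((lineExpansion φ a b (if x.1 then A else B)).coeff x.2.2).coeff x.2.1) (by
      rintro ⟨e, i, k⟩ hx
      have hx' : i < M ∧ k < L := by simpa using hx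
      have hmul : ∀ P Q : MvPolynomial (Fin n) F,
          (∀ i < M, ∀ k < L, ((lineExpansion φ a b P).coeff k).coeff i ∈ T₁) →
          (∀ i < M, ∀ k < L, ((lineExpansion φ a b Q).coeff k).coeff i ∈ T₁) →
          FormulaCost T₁ μ (((lineExpansion φ a b (P * Q)).coeff k).coeff i) := by
        intro P Q hP hQ
        rw [map_mul]
        refine (FormulaCost.coeff_coeff_mul fun i' hi' k' hk' =>
          ⟨hP i' (by omega) k' (by omega), hQ i' (by omega) k' (by omega)⟩).mono_cost
            (le_trans ?_ hμ.ge)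
        gcongr <;> omega
      cases e
      · exact (hmul (u₀ * u₁) u₀ (fun i hi k hk => (hmem₁ _ hf i hi k hk).1)
          (fun i hi k hk => (hmem₁ _ hu₀ i hi k hk).1)).mono_cost (by omega)
      · have h3 : ((lineExpansion φ a b A).coeff k).coeff i =
            ((lineExpansion φ a b (D (u₀ * u₁) * u₀)).coeff k).coeff i +
              -((lineExpansion φ a b (u₀ * u₁ * D u₀)).coeff k).coeff i := by
          rw [hA, map_sub, Polynomial.coeff_sub, Polynomial.coeff_sub, sub_eq_add_neg]
        change FormulaCost T₁ _ (((lineExpansion φ a b A).coeff k).coeff i)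
        rw [h3]
        exact FormulaCost.add
          (hmul (D (u₀ * u₁)) u₀ (fun i hi k hk => (hmem₁ _ hf i hi k hk).2)
            (fun i hi k hk => (hmem₁ _ hu₀ i hi k hk).1))
          (FormulaCost.neg (hmul (u₀ * u₁) (D u₀) (fun i hi k hk => (hmem₁ _ hf i hi k hk).1)
            (fun i hi k hk => (hmem₁ _ hu₀ i hi k hk).2))) (by omega))
  obtain ⟨T₃, -, hmem₃, hT₃⟩ := hT₂.exists_coeff_fraction φ a b hμ.ge hAB (M := M) (L := L)
    (by omega) hNdeg hcop₁ hBa hTb fun i hi k hk =>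
      ⟨hmem₂ (true, i, k) (by simp [hi, hk]), hmem₂ (false, i, k) (by simp [hi, hk])⟩
  obtain ⟨T₄, -, hmem₄, hT₄⟩ := hT₃.exists_coeff_factor φ a b hμ.ge hR0 (by omega) hcop₂ hTb hmem₃
  obtain ⟨T₅, -, hmem₅, hT₅⟩ := hT₄.extend
    (FormulaCost.sum (a := 0) (Finset.range L)
      (fun k => ((lineExpansion φ a b h).coeff k).coeff 0) fun k hk =>
        FormulaCost.mem (hmem₄ k (Finset.mem_range.1 hk) 0 (by omega)))
  rw [sum_coeff_zero_lineExpansion φ a b h (by omega)] at hmem₅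
  refine ⟨T₅, hT₅.mono ?_, hmem₅⟩
  simp only [Finset.card_product, Finset.card_univ, Fintype.card_bool, Finset.card_range]
  have hM3 : M ≤ 3 * t := by omega
  have hL2 : L ≤ 2 * t := by omega
  have hμt : μ ≤ 17 * t ^ 2 := by
    calc μ = L * (M * 2 + 2) + 1 := hμ
      _ ≤ 2 * t * (3 * t * 2 + 2 * t) + 1 * t ^ 2 := by
        gcongr
        · omega
        · rw [one_mul]; exact Nat.one_le_pow _ _ ht
      _ = 17 * t ^ 2 := by ring
  have h1t : 1 ≤ t ^ 2 := Nat.one_le_pow _ _ ht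
  have h1t3 : 1 ≤ t ^ 3 := Nat.one_le_pow _ _ ht
  have h45 : t ^ 4 ≤ t ^ 5 := Nat.pow_le_pow_right ht (by omega)
  have h15 : t ≤ t ^ 5 := Nat.le_self_pow (by omega) t
  have hML : M * L ≤ 6 * t ^ 2 := by
    calc M * L ≤ 3 * t * (2 * t) := by gcongr
      _ = 6 * t ^ 2 := by ring
  have e1 : t * (2 * (M * L) * (2 * μ + 1)) ≤ 420 * t ^ 5 := by
    calc t * (2 * (M * L) * (2 * μ + 1)) ≤ t * (2 * (6 * t ^ 2) * (35 * t ^ 2)) := by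
          gcongr; omega
      _ = 420 * t ^ 5 := by ring
  have e2 : 2 * (M * L) * (2 * μ + 3) ≤ 444 * t ^ 4 := by
    calc 2 * (M * L) * (2 * μ + 3) ≤ 2 * (6 * t ^ 2) * (37 * t ^ 2) := by
          gcongr; omega
      _ = 444 * t ^ 4 := by ring
  have e3 : L * (2 * M * (M * (2 * μ + 6) + 1)) ≤ 1452 * t ^ 5 := by
    have e4 : M * (2 * μ + 6) + 1 ≤ 121 * t ^ 3 := by
      calc M * (2 * μ + 6) + 1 ≤ 3 * t * (40 * t ^ 2) + 1 * t ^ 3 := by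
            gcongr
            · omega
            · omega
        _ = 121 * t ^ 3 := by ring
    calc L * (2 * M * (M * (2 * μ + 6) + 1)) ≤ 2 * t * (2 * (3 * t) * (121 * t ^ 3)) := by gcongr
      _ = 1452 * t ^ 5 := by ring
  rw [← mul_assoc] at e2
  have e5 : L * (0 + 1) + 1 ≤ 3 * t ^ 5 := by omega
  rw [← mul_assoc 2 M L] at e1
  simp only [← mul_assoc] at e1 e2 e3 ⊢
  omega

/-- A polynomial is computed from its irreducible factors. -/
theorem StraightLine.map_of_irreducible_factors {n : ℕ} {F K : Type*} [Field F] [Field K]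
    (φ : F →+* K) (b : ℕ) (g : MvPolynomial (Fin n) F) (hg : g ≠ 0)
    (h : ∀ q, Irreducible q → q ∣ g → ∃ S, StraightLine b S ∧ map φ q ∈ S) :
    ∃ S, StraightLine (1 + g.totalDegree * (b + 1)) S ∧ map φ g ∈ S := by
  induction g using WfDvdMonoid.induction_on_irreducible with
  | zero => exact absurd rfl hg
  | unit g hu =>
    obtain ⟨c, -, rfl⟩ := MvPolynomial.isUnit_iff_eq_C_of_isReduced.1 hu
    rw [map_C]
    exact ⟨_, (StraightLine.nil (m := 0)).step (FormulaCost.const _) |>.mono (by omega),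
      Set.mem_insert _ _⟩
  | mul g q hg0 hq ih =>
    obtain ⟨S, hS, hqS⟩ := h q hq (dvd_mul_right _ _)
    obtain ⟨T, hT, hgT⟩ := ih hg0 fun q' hq' hd => h q' hq' (hd.mul_left _)
    refine ⟨_, ((hT.union hS).step (FormulaCost.mul (FormulaCost.mem (m := 0) (Or.inr hqS))
      (FormulaCost.mem (m := 0) (Or.inl hgT)) (by omega))).mono ?_, ?_⟩
    -- An irreducible polynomial is not constant, so each factor is paid for by at least one unit of
    -- the degree of `g`.
    · have h1 : q.totalDegree ≠ 0 := fun h0 => by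
        rw [totalDegree_eq_zero_iff_eq_C] at h0
        refine hq.not_isUnit (h0 ▸ (IsUnit.mk0 _ fun h1 => hq.ne_zero ?_).map C)
        rw [h0, h1, C_0]
      rw [totalDegree_mul_of_isDomain hq.ne_zero hg0]
      nlinarith [Nat.pos_of_ne_zero h1]
    · rw [map_mul]; exact Set.mem_insert _ _

end Main

theorem mainTheorem9 :
    ∃ C : ℕ, ∀ (F : Type*) [Field F] (p : ℕ) [CharP F p], 2 ≤ p →
      ∀ (n : ℕ) (f u₀ u₁ : MvPolynomial (Fin n) F), f = u₀ * u₁ → f ≠ 0 →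
        ∀ s : ℕ, circuitSize f + circuitSize u₀ ≤ s →
          ∀ g : MvPolynomial (Fin n) F, g ∣ partialRadical p u₁ →
            circuitSize (MvPolynomial.map (algebraMap F (AlgebraicClosure F)) g) ≤
              ((C * (s + (partialRadical p u₁).totalDegree) ^ C : ℕ) : ℕ∞) := by
  -- With `x = s + deg`, the two programs together have length at most `2 * x`. The leading cost is
  -- `3 * 4000 * 2 ^ 5 = 384000` times `x ^ 6`, and `400000` also absorbs the lower terms `3 + 3 *
  -- x`; as an exponent, any `C ≥ 6` suffices.
  obtain ⟨C, hC⟩ : ∃ C, C = 400000 := ⟨_, rfl⟩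
  refine ⟨C, fun F _ p _ hp n f u₀ u₁ hf hf0 s hs g hg => ?_⟩
  subst hf
  have : Fact p.Prime :=
    ⟨(CharP.char_is_prime_or_zero F p).resolve_right fun h0 => by omega⟩
  obtain ⟨S, hS, hfS⟩ := exists_straightLine_of_circuitSize_le (le_self_add.trans hs)
  obtain ⟨T, hT, huT⟩ := exists_straightLine_of_circuitSize_le (le_add_self.trans hs)
  have hs1 : 1 ≤ s := by
    rcases Nat.eq_zero_or_pos s with rfl | h
    · cases hS
      exact absurd hfS (Set.notMem_empty _)
    · exact h
  have hr0 := partialRadical_ne_zero (p := p) u₁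
  have hgdeg := MvPolynomial.totalDegree_le_of_dvd_of_isDomain hg hr0
  have hg0 : g ≠ 0 := ne_zero_of_dvd_ne_zero hr0 hg
  obtain ⟨x, hx⟩ : ∃ x, x = s + (partialRadical p u₁).totalDegree := ⟨_, rfl⟩
  have hx1 : 1 ≤ x := by omega
  obtain ⟨S', hS', hgS'⟩ := StraightLine.map_of_irreducible_factors
    (algebraMap F (AlgebraicClosure F)) (4000 * (2 * x) ^ 5) g hg0 fun q hq hqg =>
      StraightLine.map_irreducible_factor (algebraMap F (AlgebraicClosure F)) p hf0
        ((hS.union hT).mono (by omega : s + s ≤ 2 * x)) (Or.inl hfS) (Or.inr huT) (by omega)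
        (by omega) hq (hqg.trans hg)
  refine (hS'.circuitSize_le hgS').trans ?_
  rw [← hx]
  norm_cast
  have h6 : x ^ 6 ≤ x ^ C := Nat.pow_le_pow_right hx1 (by omega)
  have h16 : 1 ≤ x ^ 6 := Nat.one_le_pow _ _ hx1
  have hx6 : x ≤ x ^ 6 := Nat.le_self_pow (by omega) x
  calc 3 * (1 + g.totalDegree * (4000 * (2 * x) ^ 5 + 1))
      ≤ 3 * (1 + x * (4000 * (2 * x) ^ 5 + 1)) := by gcongr; omega
    _ = 3 + 3 * x + 384000 * x ^ 6 := by ring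
    _ ≤ 400000 * x ^ 6 := by omega
    _ ≤ C * x ^ C := Nat.mul_le_mul hC.ge h6
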